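/- Let $n\ge 0$ and let $k,r$ be positive integers with $r\ge 2$ and $k+1$, $r-1$ coprime. Put $\beta(k,r)=-\frac{r-1}{k+1}$. A partition is written $\lambda=(\lambda_1\ge\dots\ge\lambda_n\ge 0)$; it is called $(k,r,n)$-admissible if $\lambda_i-\lambda_{i+k}\ge r$ for all $1\le i\le n-k$. Write $m_\lambda=\sum_{\alpha\in S_n\lambda}x^\alpha$ for the monomial symmetric polynomials in $x_1,\dots,x_n$, and $\mu<\lambda$ for the strict dominance order: $\mu\ne\lambda$, $|\mu|=|\lambda|$ and $\mu_1+\dots+\mu_i\le\lambda_1+\dots+\lambda_i$ for $1\le i\le n$. Let $K_{ij}$ be the operator exchanging $x_i$ and $x_j$, and on $\mathbb C(\beta)[x_1,\dots,x_n]$ let $$\nabla_i=\frac{\partial}{\partial x_i}+\beta\sum_{j\ne i}\frac{1}{x_i-x_j}(1-K_{ij}),\qquad \hat D_i=x_i\nabla_i+\beta\sum_{j=i+1}^{n}K_{ij},\qquad S(u,\beta)=\prod_{i=1}^n(u+\hat D_i).$$ The Jack polynomial $P_\lambda$ is the element of $\mathbb C(\beta)[x_1,\dots,x_n]^{S_n}$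 such that $$P_\lambda=m_\lambda+\sum_{\mu<\lambda}u_{\lambda\mu}(\beta)\,m_\mu\quad (u_{\lambda\mu}\in\mathbb C(\beta)),\qquad S(u,\beta)P_\lambda=\prod_{i=1}^n\bigl(u+\lambda_i+(n-i)\beta\bigr)\,P_\lambda\ \text{ for all } u.$$ **Proposition.** Let $\mu=(\mu_1\ge\dots\ge\mu_n\ge0)$ be a $(k,r,n)$-admissible partition, and let the partition $\lambda=(\lambda_1\ge\dots\ge\lambda_n\ge0)$ be obtained from $\mu$ by adding one node to its Young diagram or by removing one node from it, or let $\lambda=\mu$. Then $P_\lambda$ exists, is uniquely determined by the two properties above, and has no pole at $\beta=\beta(k,r)$; that is, none of its coefficients in $\mathbb C(\beta)$ has a pole at $\beta=\beta(k,r)$. -/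

import Mathlib

namespace JackPoly

section Operators

variable {R : Type*} [CommRing R] {n : ℕ}

/-- The operator `K_ij` exchanging the variables `x_i` and `x_j`. -/
noncomputable def exch (R : Type*) [CommRing R] {n : ℕ} (i j : Fin n) :
    Module.End R (MvPolynomial (Fin n) R) :=
  (MvPolynomial.rename (R := R) (Equiv.swap i j)).toLinearMap

theorem sub_dvd_sub_exch (i j : Fin n) (f : MvPolynomial (Fin n) R) :
    (MvPolynomial.X i - MvPolynomial.X j : MvPolynomial (Fin n) R) ∣ f - exch R i j f := by
  rw [← Ideal.mem_span_singleton, ← Ideal.Quotient.eq]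
  set I : Ideal (MvPolynomial (Fin n) R) :=
    Ideal.span {MvPolynomial.X i - MvPolynomial.X j} with hI
  have key : Ideal.Quotient.mk I (MvPolynomial.X i) = Ideal.Quotient.mk I (MvPolynomial.X j) :=
    Ideal.Quotient.eq.2 (Ideal.mem_span_singleton_self _)
  have h : Ideal.Quotient.mkₐ R I =
      (Ideal.Quotient.mkₐ R I).comp (MvPolynomial.rename (Equiv.swap i j)) := by
    apply MvPolynomial.algHom_ext
    intro m
    simp only [AlgHom.comp_apply, MvPolynomial.rename_X, Ideal.Quotient.mkₐ_eq_mk]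
    rcases eq_or_ne m i with rfl | hi
    · rw [Equiv.swap_apply_left, key]
    · rcases eq_or_ne m j with rfl | hj
      · rw [Equiv.swap_apply_right, key]
      · rw [Equiv.swap_apply_of_ne_of_ne hi hj]
  exact DFunLike.congr_fun h f

variable [IsDomain R]

theorem X_sub_X_ne_zero {i j : Fin n} (h : i ≠ j) :
    (MvPolynomial.X i - MvPolynomial.X j : MvPolynomial (Fin n) R) ≠ 0 :=
  sub_ne_zero.2 fun e => h (MvPolynomial.X_injective e)

/-- The divided difference `(x_i - x_j)⁻¹ (1 - K_ij)` on polynomials, for `i ≠ j`: the value at `f`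
is the exact quotient of `f - K_ij f` by `x_i - x_j`. -/
noncomputable def divDiff (R : Type*) [CommRing R] [IsDomain R] {n : ℕ} (i j : Fin n) :
    Module.End R (MvPolynomial (Fin n) R) :=
  if h : i = j then 0 else
    { toFun := fun f => Classical.choose (sub_dvd_sub_exch i j f)
      map_add' := fun f g => by
        apply mul_left_cancel₀ (X_sub_X_ne_zero (R := R) h)
        rw [mul_add, ← Classical.choose_spec (sub_dvd_sub_exch i j (f + g)),
          ← Classical.choose_spec (sub_dvd_sub_exch i j f),
          ← Classical.choose_spec (sub_dvd_sub_exch i j g), map_add]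
        ring
      map_smul' := fun c f => by
        apply mul_left_cancel₀ (X_sub_X_ne_zero (R := R) h)
        rw [RingHom.id_apply, mul_smul_comm,
          ← Classical.choose_spec (sub_dvd_sub_exch i j (c • f)),
          ← Classical.choose_spec (sub_dvd_sub_exch i j f), map_smul, smul_sub] }

theorem X_sub_X_mul_divDiff {i j : Fin n} (h : i ≠ j) (f : MvPolynomial (Fin n) R) :
    (MvPolynomial.X i - MvPolynomial.X j) * divDiff R i j f = f - exch R i j f := by
  rw [divDiff, dif_neg h]
  exact (Classical.choose_spec (sub_dvd_sub_exch i j f)).symm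

/-- The Dunkl operator `∇_i = ∂_i + b ∑_{j ≠ i} (x_i - x_j)⁻¹ (1 - K_ij)`. -/
noncomputable def dunkl (b : R) (i : Fin n) : Module.End R (MvPolynomial (Fin n) R) :=
  (MvPolynomial.pderiv (R := R) i : MvPolynomial (Fin n) R →ₗ[R] MvPolynomial (Fin n) R) +
    b • ∑ j ∈ Finset.univ.erase i, divDiff R i j

/-- The Cherednik operator `x_i ∇_i + b ∑_{j > i} K_ij`. -/
noncomputable def cherednik (b : R) (i : Fin n) : Module.End R (MvPolynomial (Fin n) R) :=
  LinearMap.mulLeft R (MvPolynomial.X i) * dunkl b i + b • ∑ j ∈ Finset.Ioi i, exch R i j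

/-- The Sekiguchi operator `S(u, b)`, the product over `i`, in increasing order, of `u` plus the
`i`-th Cherednik operator (these factors commute). -/
noncomputable def sekiguchi (n : ℕ) (b u : R) : Module.End R (MvPolynomial (Fin n) R) :=
  (List.ofFn fun i : Fin n => u • (1 : Module.End R (MvPolynomial (Fin n) R)) + cherednik b i).prod

/-- The eigenvalue `∏_{i=1}^n (u + lam_i + (n - i) b)`; the index here starts at `0`. -/
def eigenvalue (b u : R) (lam : Fin n → ℕ) : R :=
  ∏ i : Fin n, (u + (lam i : R) + ((n : R) - ((i : ℕ) + 1)) * b)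

end Operators

/-- Strict dominance `mu < lam` of partitions with at most `n` parts. -/
def StrictDom {n : ℕ} (mu lam : Fin n → ℕ) : Prop :=
  mu ≠ lam ∧ ∑ i, mu i = ∑ i, lam i ∧
    ∀ i : Fin n, ∑ j ∈ Finset.Iic i, mu j ≤ ∑ j ∈ Finset.Iic i, lam j

/-- The monomial symmetric polynomial `m_lam`, the sum of the `x^a` over all distinct
rearrangements `a` of `lam`. -/
noncomputable def monSymm (R : Type*) [CommRing R] {n : ℕ} (lam : Fin n → ℕ) :
    MvPolynomial (Fin n) R :=
  ∑ a ∈ Finset.univ.image (fun s : Equiv.Perm (Fin n) => lam ∘ s),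
    MvPolynomial.monomial (Finsupp.equivFunOnFinite.symm a) (1 : R)

/-- `P` is the Jack polynomial of the partition `lam` in `n` variables over `ℂ(β)`, with
`β = RatFunc.X`: it is `m_lam` plus a `ℂ(β)`-linear combination of the `m_mu` with `mu < lam`, and
an eigenvector of the Sekiguchi operators. -/
def IsJack {n : ℕ} (lam : Fin n → ℕ) (P : MvPolynomial (Fin n) (RatFunc ℂ)) : Prop :=
  P - monSymm (RatFunc ℂ) lam ∈ Submodule.span (RatFunc ℂ)
      {p | ∃ mu : Fin n → ℕ, Antitone mu ∧ StrictDom mu lam ∧ p = monSymm (RatFunc ℂ) mu} ∧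
    ∀ u : RatFunc ℂ, sekiguchi n RatFunc.X u P = eigenvalue RatFunc.X u lam • P

/-- No coefficient of `P`, written in lowest terms, has a pole at `β = b`. -/
def NoPoleAt {n : ℕ} (P : MvPolynomial (Fin n) (RatFunc ℂ)) (b : ℂ) : Prop :=
  ∀ a : Fin n →₀ ℕ, (P.coeff a).denom.eval b ≠ 0

/-- `mu` is `(k, r, n)`-admissible: it is a partition with at most `n` parts and
`mu_i - mu_{i+k} ≥ r` whenever `i` and `i + k` are both indices. -/
def Admissible {n : ℕ} (k r : ℕ) (mu : Fin n → ℕ) : Prop :=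
  Antitone mu ∧ ∀ i j : Fin n, (j : ℕ) = i + k → mu j + r ≤ mu i

/-- `lam` is obtained from `mu` by adding one node, in some row `i`. -/
def AddNode {n : ℕ} (mu lam : Fin n → ℕ) : Prop :=
  ∃ i : Fin n, lam = Function.update mu i (mu i + 1)

end JackPoly

/-!
A Jack polynomial is the spectral projection of `m_lam` onto an eigenspace of a single Sekiguchi
operator, so it can have a pole at `β = b` only if the eigenvalue at `lam` collides at `β = b`
with the eigenvalue at a partition below `lam`. The proof makes this precise and shows that no
such collision occurs.

*Operators.* The commutator of two Dunkl operators commutes with multiplication by every variable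
and kills constants, so it vanishes (`dunkl_comm`). Hence the Cherednik operators commute, and with
the relations of the degenerate affine Hecke algebra (`exch_cherednik_left`) the Sekiguchi operators
commute with each other and with the adjacent transpositions (`sekiguchi_commute`,
`exch_commute_sekiguchi`); in particular they preserve symmetric polynomials.

*Triangularity.* On polynomials all of whose exponents are majorized by a partition `lam`, each
Cherednik operator multiplies the coefficient of `x^lam` by its expected eigenvalue
(`triangular_cherednik`); this is checked one pair of variables at a time, on monomials
(`triangular_pair`). So `S(u)` minus the eigenvalue at `lam` maps `m_lam` to the span of the `m_mu`
with `mu < lam`, and the product of `S(u)` minus eigenvalue over all `mu < lam` kills that span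
(`aeval_lowerPoly_eq_zero`). If some `u` separates the eigenvalue at `lam` from those below it,
applying this product to `m_lam` and normalizing gives the unique Jack polynomial (`jackProj`,
`sekiguchi_jackProj`, `IsJack.eq`). All operators are defined over the ring of rational functions
regular at `b`, so the only denominators are differences of eigenvalues, and separation at `β = b`
excludes a pole (`jackProj_mem_regularPoly`).

*Separation.* Since `k + 1` and `r - 1` are coprime, `lam` and `mu` have the same eigenvalue at
`β = -(r-1)/(k+1)` only if `mu_q = lam_{w q} + (r-1) m` for a permutation `w` with
`w q = q + (k+1) m`. If `lam_i - lam_{i+k} ≥ r` for all `i` but one, where the difference is at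
least `r - 1`, this forces `mu = lam` when the sizes agree (`eq_of_shifted_perm`).
-/

namespace JackPoly

/-! ### Partitions with the same eigenvalue at `β = -(r-1)/(k+1)` -/

/-- Iterating the gap condition `m` times loses at most one, however long the chain, since the
exceptional index `a` is met at most once. -/
theorem gap_mul {n k a : ℕ} {r : ℤ} (hk : 1 ≤ k) {L : ℕ → ℤ}
    (gap : ∀ i, i + k < n → L (i + k) + r ≤ L i + if i = a then 1 else 0) (m i : ℕ)
    (h : i + k * m < n) :
    L (i + k * m) + r * m ≤ L i + if i ≤ a ∧ a < i + k * m then 1 else 0 := by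
  induction m with
  | zero => simp; split_ifs <;> simp
  | succ m ih =>
    rw [Nat.mul_succ, ← add_assoc] at h ⊢
    have h1 := ih (by omega)
    have h2 := gap (i + k * m) h
    push_cast
    have h3 : r * ((m : ℤ) + 1) = r * m + r := by ring
    rw [h3]
    generalize k * m = t at *
    generalize r * (m : ℤ) = z at *
    split_ifs at * <;> omega

/-- The combinatorial core. Rows where `N` exceeds `L` propagate upwards, and would reach the top
row, unless they stop at row `a + k + 1`; rows where `N` is below `L` propagate downwards unless
they stop at row `a - 1`. So `N` and `L` agree on rows `a` to `a + k`; then the shifted value of `L`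
at `a` is taken by `N` both at `a` and at `a + k + 1`, so by injectivity of `w` it recurs in `L`, and
it can do so only at `a + k + 1`; but then `N` and `L` agree there too, a contradiction. -/
theorem eq_of_shifted_perm {n k a : ℕ} {r : ℤ} (hk : 1 ≤ k) {L N : ℕ → ℤ}
    (hL : ∀ i j, i ≤ j → j < n → L j ≤ L i) (hN : ∀ i j, i ≤ j → j < n → N j ≤ N i)
    (gap : ∀ i, i + k < n → L (i + k) + r ≤ L i + if i = a then 1 else 0)
    {w : ℕ → ℕ} (hw : ∀ q < n, w q < n) (winj : ∀ p < n, ∀ q < n, w p = w q → p = q)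
    (hm : ∀ q < n, ∃ m : ℤ, (w q : ℤ) = q + (k + 1) * m ∧ N q = L (w q) + (r - 1) * m)
    (hsum : ∑ q ∈ Finset.range n, N q = ∑ q ∈ Finset.range n, L q) :
    ∀ q < n, N q = L q := by
  have gapm := gap_mul hk gap
  -- The only way for the upward propagation to stop is `m = -1` at the exceptional pair.
  have hA : ∀ q < n, L q < N q →
      1 ≤ q ∧ (L (q - 1) < N (q - 1) ∨ (q = a + k + 1 ∧ N q = L a - (r - 1))) := by
    intro q hq hlt
    obtain ⟨m, hm1, hm2⟩ := hm q hq
    have hwq := hw q hq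
    rcases le_or_gt 0 m with h0 | h0
    · obtain ⟨m, rfl⟩ := Int.eq_ofNat_of_zero_le h0
      have e : w q = q + k * m + m := by
        zify; rw [hm1]; ring
      rcases Nat.eq_zero_or_pos m with rfl | hpos
      · simp at hm2 e; rw [e] at hm2; omega
      · have h1 := gapm m q (by omega)
        have h2 := hL (q + k * m) (w q) (by omega) hwq
        have : (r - 1) * (m : ℤ) = r * m - m := by ring
        rw [this] at hm2
        generalize r * (m : ℤ) = z at *
        split_ifs at h1 <;> omega
    · obtain ⟨m, rfl⟩ : ∃ m' : ℕ, m = -(m' : ℤ) := ⟨m.toNat + (-m).toNat, by omega⟩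
      have e : q = w q + k * m + m := by
        zify; rw [hm1]; ring
      have hpos : 1 ≤ m := by omega
      refine ⟨by omega, ?_⟩
      have h1 := gapm m (w q) (by omega)
      have h2 := hL (w q + k * m) (q - 1) (by omega) (by omega)
      have h3 := hN (q - 1) q (by omega) hq
      have : (r - 1) * (-(m : ℤ)) = - (r * m) + m := by ring
      rw [this] at hm2
      rcases Nat.lt_or_ge 1 m with h | h
      · left
        generalize r * (m : ℤ) = z at *
        split_ifs at h1 <;> omega
      · obtain rfl : m = 1 := by omega
        have h4 := gap (w q) (by omega)
        simp only [mul_one, Nat.cast_one] at *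
        split_ifs at h4 with h5
        · rw [h5] at e hm2
          right
          exact ⟨e, by omega⟩
        · left; omega
  -- Dually, the downward propagation stops only for `m = 1` at the exceptional pair.
  have hB : ∀ q < n, N q < L q → q + 1 < n ∧ (N (q + 1) < L (q + 1) ∨ q + 1 = a) := by
    intro q hq hlt
    obtain ⟨m, hm1, hm2⟩ := hm q hq
    have hwq := hw q hq
    rcases lt_or_ge 0 m with h0 | h0
    · obtain ⟨m, rfl⟩ := Int.eq_ofNat_of_zero_le h0.le
      have e : w q = q + k * m + m := by
        zify; rw [hm1]; ring
      have hpos : 1 ≤ m := by omega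
      refine ⟨by omega, ?_⟩
      have h1 := gapm m (q + 1) (by omega)
      have h2 := hL (q + 1 + k * m) (w q) (by omega) (by omega)
      have h3 := hN q (q + 1) (by omega) (by omega)
      have : (r - 1) * (m : ℤ) = r * m - m := by ring
      rw [this] at hm2
      rcases Nat.lt_or_ge 1 m with h | h
      · left
        generalize r * (m : ℤ) = z at *
        split_ifs at h1 <;> omega
      · obtain rfl : m = 1 := by omega
        have h4 := gap (q + 1) (by omega)
        simp only [mul_one, Nat.cast_one] at *
        split_ifs at h4 with h5
        · exact Or.inr h5
        · left; omega
    · obtain ⟨m, rfl⟩ : ∃ m' : ℕ, m = -(m' : ℤ) := ⟨m.toNat + (-m).toNat, by omega⟩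
      have e : q = w q + k * m + m := by
        zify; rw [hm1]; ring
      rcases Nat.eq_zero_or_pos m with rfl | hpos
      · simp at hm2 e; rw [← e] at hm2; omega
      · have h1 := gapm m (w q) (by omega)
        have h2 := hL (w q + k * m) q (by omega) hq
        have : (r - 1) * (-(m : ℤ)) = - (r * m) + m := by ring
        rw [this] at hm2
        generalize r * (m : ℤ) = z at *
        split_ifs at h1 <;> omega
  have hA' : ∀ q < n, q ≤ a + k → ¬ L q < N q := by
    intro q
    induction q with
    | zero => intro hq _ h; exact absurd (hA 0 hq h).1 (by omega)
    | succ q ih =>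
      intro hq hle h
      rcases (hA _ hq h).2 with h1 | h1
      · exact ih (by omega) (by omega) (by simpa using h1)
      · omega
  have hB' : ∀ d q, q + d + 1 = n → a ≤ q → ¬ N q < L q := by
    intro d
    induction d with
    | zero => intro q hq _ h; exact absurd (hB q (by omega) h).1 (by omega)
    | succ d ih =>
      intro q hq hle h
      rcases (hB q (by omega) h).2 with h1 | h1
      · exact ih (q + 1) (by omega) (by omega) h1
      · omega
  by_cases hne : ∃ q < n, L q < N q
  · exfalso
    obtain ⟨q, hq, hlt⟩ := hne
    have hex : a + k + 1 < n ∧ L (a + k + 1) < N (a + k + 1) ∧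
        N (a + k + 1) = L a - (r - 1) := by
      induction q with
      | zero => exact absurd (hA 0 hq hlt).1 (by omega)
      | succ q ih =>
        rcases (hA _ hq hlt).2 with h1 | ⟨h1, h2⟩
        · exact ih (by omega) (by simpa using h1)
        · rw [h1] at h2 hq hlt; exact ⟨hq, hlt, h2⟩
    obtain ⟨hn, hlt', heq⟩ := hex
    have hNa : N a = L a := by
      have h1 := hA' a (by omega) (by omega)
      have h2 := hB' (n - 1 - a) a (by omega) le_rfl
      omega
    -- the shifted value of `L` at `a` can recur in its class only at `a + k + 1`
    have key : ∀ p < n, ∀ M : ℤ, M ≠ 0 → (p : ℤ) = a + (k + 1) * M →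
        L a = L p + (r - 1) * M → False := by
      intro p hp M hM hpM hLp
      rcases lt_or_ge 0 M with h0 | h0
      · obtain ⟨m, rfl⟩ := Int.eq_ofNat_of_zero_le h0.le
        have e : p = a + k * m + m := by zify; rw [hpM]; ring
        have h1 := gapm m a (by omega)
        have h2 := hL (a + k * m) p (by omega) hp
        have : (r - 1) * (m : ℤ) = r * m - m := by ring
        have hm1 : m = 1 := by
          rw [this] at hLp
          generalize r * (m : ℤ) = z at *
          split_ifs at h1 <;> omega
        subst hm1
        simp only [mul_one, Nat.cast_one] at *
        rw [e] at hLp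
        omega
      · obtain ⟨m, rfl⟩ : ∃ m' : ℕ, M = -(m' : ℤ) := ⟨M.toNat + (-M).toNat, by omega⟩
        have e : a = p + k * m + m := by zify; rw [hpM]; ring
        have h1 := gapm m p (by omega)
        have h2 := hL (p + k * m) a (by omega) (by omega)
        have : (r - 1) * (-(m : ℤ)) = - (r * m) + m := by ring
        rw [this] at hLp
        rw [if_neg (by omega)] at h1; omega
    obtain ⟨m1, hw1, hv1⟩ := hm a (by omega)
    obtain ⟨m2, hw2, hv2⟩ := hm (a + k + 1) hn
    by_cases h1 : m1 = 0
    · refine key _ (hw _ hn) (1 + m2) (fun h2 => ?_) (by rw [hw2]; push_cast; ring)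
        (by linarith)
      have h3 := winj a (by omega) (a + k + 1) hn (by
        zify; rw [hw1, hw2, h1]
        have : m2 = -1 := by omega
        rw [this]; push_cast; ring)
      omega
    · exact key _ (hw a (by omega)) m1 h1 hw1 (by linarith)
  · push Not at hne
    have := (Finset.sum_eq_sum_iff_of_le (s := Finset.range n) (f := N) (g := L)
      (fun q hq => hne q (Finset.mem_range.1 hq))).1 hsum
    exact fun q hq => this q (Finset.mem_range.2 hq)

/-! ### Relations between the Dunkl and Cherednik operators -/

open MvPolynomial

section Operators

variable {R : Type*} [CommRing R] {n : ℕ}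

theorem exch_apply (i j : Fin n) (f : MvPolynomial (Fin n) R) :
    exch R i j f = rename (Equiv.swap i j) f := rfl

theorem exch_comm (i j : Fin n) : exch R i j = exch R j i := by
  rw [exch, exch, Equiv.swap_comm]

theorem exch_exch (i j : Fin n) (f : MvPolynomial (Fin n) R) : exch R i j (exch R i j f) = f := by
  rw [exch_apply, exch_apply, rename_rename, ← Equiv.coe_trans]
  simp

theorem exch_X_mul (i j l : Fin n) (f : MvPolynomial (Fin n) R) :
    exch R i j (X l * f) = X (Equiv.swap i j l) * exch R i j f := by
  simp [exch_apply]

theorem rename_exch (s : Equiv.Perm (Fin n)) (i j : Fin n) (f : MvPolynomial (Fin n) R) :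
    rename s (exch R i j f) = exch R (s i) (s j) (rename s f) := by
  rw [exch_apply, exch_apply, rename_rename, rename_rename]
  congr 2
  ext x
  simp [Equiv.swap_apply_apply]

/-- The Jucys–Murphy sums `∑_{a > i} K_ia` commute with `K_jc` when `j` and `c` exceed `i`. -/
theorem sum_exch_exch {i j c : Fin n} (hj : i < j) (hc : i < c) (f : MvPolynomial (Fin n) R) :
    ∑ a ∈ Finset.Ioi i, exch R i a (exch R j c f) =
      exch R j c (∑ a ∈ Finset.Ioi i, exch R i a f) := by
  rw [map_sum]
  refine Finset.sum_equiv (Equiv.swap j c) (fun a => ?_) fun a _ => ?_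
  · simp only [Finset.mem_Ioi, Equiv.swap_apply_def]
    split_ifs <;> simp_all
  · rw [exch_apply j c (exch R i _ f), rename_exch,
      Equiv.swap_apply_of_ne_of_ne hj.ne hc.ne, Equiv.swap_apply_self]
    rfl

variable [IsDomain R]

theorem divDiff_self (i : Fin n) : divDiff R i i = 0 := by simp [divDiff]

theorem eq_divDiff {i j : Fin n} (h : i ≠ j) {f g : MvPolynomial (Fin n) R}
    (hg : (X i - X j) * g = f - exch R i j f) : divDiff R i j f = g :=
  mul_left_cancel₀ (X_sub_X_ne_zero h) ((X_sub_X_mul_divDiff h f).trans hg.symm)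

theorem rename_divDiff (s : Equiv.Perm (Fin n)) (i j : Fin n) (f : MvPolynomial (Fin n) R) :
    rename s (divDiff R i j f) = divDiff R (s i) (s j) (rename s f) := by
  rcases eq_or_ne i j with rfl | h
  · simp [divDiff_self]
  · symm
    apply eq_divDiff (s.injective.ne h)
    rw [← rename_exch, ← map_sub, ← X_sub_X_mul_divDiff h]
    simp

theorem divDiff_X_mul {i j : Fin n} (h : i ≠ j) (l : Fin n) (f : MvPolynomial (Fin n) R) :
    divDiff R i j (X l * f) = X l * divDiff R i j f +
      ((if l = i then 1 else 0) - (if l = j then 1 else 0)) * exch R i j f := by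
  apply eq_divDiff h
  rw [exch_X_mul]
  have e := X_sub_X_mul_divDiff h f
  rcases eq_or_ne l i with rfl | hi
  · rw [if_pos rfl, if_neg h, Equiv.swap_apply_left]
    linear_combination X l * e
  · rcases eq_or_ne l j with rfl | hj
    · rw [if_pos rfl, if_neg hi, Equiv.swap_apply_right]
      linear_combination X l * e
    · rw [if_neg hj, if_neg hi, Equiv.swap_apply_of_ne_of_ne hi hj]
      linear_combination X l * e

theorem dunkl_apply (b : R) (i : Fin n) (f : MvPolynomial (Fin n) R) :
    dunkl b i f = pderiv i f + b • ∑ j ∈ Finset.univ.erase i, divDiff R i j f := by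
  simp [dunkl]

theorem rename_dunkl (b : R) (s : Equiv.Perm (Fin n)) (i : Fin n) (f : MvPolynomial (Fin n) R) :
    rename s (dunkl b i f) = dunkl b (s i) (rename s f) := by
  rw [dunkl_apply, dunkl_apply, map_add, map_smul, map_sum, pderiv_rename s.injective]
  congr 2
  refine Finset.sum_equiv s (fun j => by simp) fun j _ => rename_divDiff s i j f

theorem exch_dunkl (b : R) (i j l : Fin n) (f : MvPolynomial (Fin n) R) :
    exch R i j (dunkl b l f) = dunkl b (Equiv.swap i j l) (exch R i j f) :=
  rename_dunkl b _ l f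

theorem dunkl_X_mul_of_ne (b : R) {i l : Fin n} (h : l ≠ i) (f : MvPolynomial (Fin n) R) :
    dunkl b i (X l * f) = X l * dunkl b i f - b • exch R i l f := by
  have : ∑ j ∈ Finset.univ.erase i, divDiff R i j (X l * f) =
      X l * ∑ j ∈ Finset.univ.erase i, divDiff R i j f - exch R i l f := by
    rw [Finset.sum_congr rfl fun j hj => divDiff_X_mul (Finset.ne_of_mem_erase hj).symm l f]
    rw [Finset.sum_add_distrib, ← Finset.mul_sum, sub_eq_add_neg]
    simp [h]
  rw [dunkl_apply, dunkl_apply, this, Derivation.leibniz]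
  simp only [pderiv_X_of_ne h, smul_eq_mul, smul_sub, mul_add, mul_smul_comm]
  ring

theorem dunkl_X_mul_self (b : R) (i : Fin n) (f : MvPolynomial (Fin n) R) :
    dunkl b i (X i * f) =
      X i * dunkl b i f + f + b • ∑ j ∈ Finset.univ.erase i, exch R i j f := by
  have : ∑ j ∈ Finset.univ.erase i, divDiff R i j (X i * f) =
      X i * ∑ j ∈ Finset.univ.erase i, divDiff R i j f +
        ∑ j ∈ Finset.univ.erase i, exch R i j f := by
    rw [Finset.mul_sum, ← Finset.sum_add_distrib]
    refine Finset.sum_congr rfl fun j hj => ?_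
    have hj := (Finset.ne_of_mem_erase hj).symm
    rw [divDiff_X_mul hj, if_pos rfl, if_neg hj]
    ring
  rw [dunkl_apply, dunkl_apply, this, Derivation.leibniz]
  simp only [pderiv_X_self, smul_eq_mul, smul_add, mul_add, mul_smul_comm]
  ring

theorem dunkl_C (b : R) (i : Fin n) (c : R) : dunkl b i (C c) = 0 := by
  rw [dunkl_apply, pderiv_C, Finset.sum_eq_zero, smul_zero, add_zero]
  intro j hj
  apply eq_divDiff (Finset.ne_of_mem_erase hj).symm
  simp [exch_apply]

theorem dunkl_dunkl_X_mul (b : R) {i j : Fin n} (h : i ≠ j) (f : MvPolynomial (Fin n) R) :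
    dunkl b i (dunkl b j (X i * f)) - dunkl b j (dunkl b i (X i * f)) =
      X i * (dunkl b i (dunkl b j f) - dunkl b j (dunkl b i f)) := by
  rw [dunkl_X_mul_of_ne b h, dunkl_X_mul_self]
  simp only [map_add, map_sub, map_smul, map_sum]
  rw [dunkl_X_mul_of_ne b h, dunkl_X_mul_self]
  have e : ∑ l ∈ Finset.univ.erase i, exch R i l (dunkl b j f) -
        ∑ l ∈ Finset.univ.erase i, dunkl b j (exch R i l f) =
      dunkl b i (exch R i j f) - dunkl b j (exch R i j f) := by
    rw [← Finset.sum_sub_distrib, Finset.sum_eq_single j]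
    · rw [exch_dunkl, Equiv.swap_apply_right]
    · intro l hl hlj
      rw [exch_dunkl, Equiv.swap_apply_of_ne_of_ne h.symm hlj.symm, sub_self]
    · intro hj; exact absurd (Finset.mem_erase.2 ⟨h.symm, Finset.mem_univ _⟩) hj
  have e2 : exch R j i (dunkl b i f) = dunkl b j (exch R i j f) := by
    rw [exch_dunkl, Equiv.swap_apply_right, exch_comm]
  rw [e2, exch_comm j i]
  simp only [smul_eq_C_mul]
  linear_combination C b * e

/-- The commutator of two Dunkl operators commutes with multiplication by every variable and
kills constants. -/
theorem dunkl_comm (b : R) (i j : Fin n) (f : MvPolynomial (Fin n) R) :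
    dunkl b i (dunkl b j f) = dunkl b j (dunkl b i f) := by
  rcases eq_or_ne i j with rfl | h
  · rfl
  induction f using MvPolynomial.induction_on with
  | C c => simp [dunkl_C]
  | add p q hp hq => simp only [map_add, hp, hq]
  | mul_X p l hp =>
    rw [mul_comm, ← sub_eq_zero]
    rcases eq_or_ne l i with rfl | hi
    · rw [dunkl_dunkl_X_mul b h, hp, sub_self, mul_zero]
    · rcases eq_or_ne l j with rfl | hj
      · rw [← neg_eq_zero, neg_sub, dunkl_dunkl_X_mul b h.symm, hp, sub_self, mul_zero]
      · rw [dunkl_X_mul_of_ne b hi, dunkl_X_mul_of_ne b hj]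
        simp only [map_sub, map_smul]
        rw [dunkl_X_mul_of_ne b hi, dunkl_X_mul_of_ne b hj, hp, exch_dunkl, exch_dunkl,
          Equiv.swap_apply_of_ne_of_ne h.symm hj.symm, Equiv.swap_apply_of_ne_of_ne h hi.symm]
        ring

theorem cherednik_apply (b : R) (i : Fin n) (f : MvPolynomial (Fin n) R) :
    cherednik b i f = X i * dunkl b i f + b • ∑ j ∈ Finset.Ioi i, exch R i j f := by
  simp [cherednik]

theorem X_mul_dunkl_comm (b : R) {i j : Fin n} (h : i ≠ j) (f : MvPolynomial (Fin n) R) :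
    X i * dunkl b i (X j * dunkl b j f) - X j * dunkl b j (X i * dunkl b i f) =
      b • exch R i j (X i * dunkl b i f - X j * dunkl b j f) := by
  rw [dunkl_X_mul_of_ne b h.symm, dunkl_X_mul_of_ne b h, dunkl_comm b j i, exch_comm j i, map_sub,
    exch_X_mul, exch_X_mul, Equiv.swap_apply_left, Equiv.swap_apply_right]
  simp only [smul_eq_C_mul]
  ring

/-- The Dunkl parts contribute `b K_ij (x_i ∇_i - x_j ∇_j)`, which the exchange operator `K_ij` in
the `i`-th Cherednik operator cancels; the remaining exchange operators commute by
`sum_exch_exch`. -/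
theorem cherednik_comm_of_lt (b : R) {i j : Fin n} (h : i < j) (f : MvPolynomial (Fin n) R) :
    cherednik b i (cherednik b j f) = cherednik b j (cherednik b i f) := by
  have e1 := X_mul_dunkl_comm b h.ne f
  have e2 : ∑ a ∈ Finset.Ioi i, exch R i a (X j * dunkl b j f) -
      X j * ∑ a ∈ Finset.Ioi i, dunkl b j (exch R i a f) =
        exch R i j (X j * dunkl b j f - X i * dunkl b i f) := by
    rw [Finset.mul_sum, ← Finset.sum_sub_distrib, Finset.sum_eq_single j]
    · rw [map_sub, exch_X_mul, exch_X_mul, exch_dunkl, exch_dunkl, Equiv.swap_apply_left,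
        Equiv.swap_apply_right]
    · intro l hl hlj
      rw [exch_X_mul, exch_dunkl, Equiv.swap_apply_of_ne_of_ne h.ne' hlj.symm, sub_self]
    · intro hj; exact absurd (Finset.mem_Ioi.2 h) hj
  have e3 : X i * ∑ a ∈ Finset.Ioi j, dunkl b i (exch R j a f) =
      ∑ a ∈ Finset.Ioi j, exch R j a (X i * dunkl b i f) := by
    rw [Finset.mul_sum]
    refine Finset.sum_congr rfl fun a ha => ?_
    have ha := Finset.mem_Ioi.1 ha
    rw [exch_X_mul, exch_dunkl, Equiv.swap_apply_of_ne_of_ne h.ne (h.trans ha).ne]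
  have e4 : ∑ c ∈ Finset.Ioi j, ∑ a ∈ Finset.Ioi i, exch R i a (exch R j c f) =
      ∑ a ∈ Finset.Ioi i, ∑ c ∈ Finset.Ioi j, exch R j c (exch R i a f) := by
    rw [Finset.sum_comm (s := Finset.Ioi i)]
    refine Finset.sum_congr rfl fun c hc => ?_
    rw [sum_exch_exch h (h.trans (Finset.mem_Ioi.1 hc)), map_sum]
  simp only [cherednik_apply, map_add, map_smul, map_sum, smul_add, Finset.sum_add_distrib,
    ← Finset.smul_sum, Finset.mul_sum] at e1 e2 e3 ⊢
  rw [map_sub] at e1 e2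
  simp only [smul_eq_C_mul] at *
  linear_combination e1 + C b * e2 + C b * e3 + C b ^ 2 * e4

theorem cherednik_commute (b : R) (i j : Fin n) : Commute (cherednik b i) (cherednik b j) := by
  rcases lt_trichotomy i j with h | rfl | h
  · exact LinearMap.ext fun f => cherednik_comm_of_lt b h f
  · exact Commute.refl _
  · exact (LinearMap.ext fun f => cherednik_comm_of_lt b h f : Commute _ _).symm

/-- A simple transposition commutes with the Cherednik operators of the other indices. -/
theorem exch_cherednik_of_ne (b : R) {i j l : Fin n} (hij : (j : ℕ) = i + 1) (hi : l ≠ i)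
    (hj : l ≠ j) (f : MvPolynomial (Fin n) R) :
    exch R i j (cherednik b l f) = cherednik b l (exch R i j f) := by
  rw [cherednik_apply, cherednik_apply, map_add, map_smul, exch_X_mul, exch_dunkl,
    Equiv.swap_apply_of_ne_of_ne hi hj, map_sum]
  congr 2
  refine Finset.sum_equiv (Equiv.swap i j) (fun a => ?_) fun a _ => ?_
  · rw [Finset.mem_Ioi, Finset.mem_Ioi, Equiv.swap_apply_def]
    split_ifs with h1 h2
    · subst h1; omega
    · subst h2; omega
    · rfl
  · rw [exch_apply i j (exch R l a f), rename_exch, Equiv.swap_apply_of_ne_of_ne hi hj]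
    rfl

/-- The relation of the degenerate affine Hecke algebra. -/
theorem exch_cherednik_left (b : R) {i j : Fin n} (hij : (j : ℕ) = i + 1)
    (f : MvPolynomial (Fin n) R) :
    exch R i j (cherednik b i f) = cherednik b j (exch R i j f) + b • f := by
  have hI : Finset.Ioi i = insert j (Finset.Ioi j) := by
    ext a; simp only [Finset.mem_Ioi, Finset.mem_insert]; omega
  rw [cherednik_apply, cherednik_apply, map_add, map_smul, exch_X_mul, exch_dunkl,
    Equiv.swap_apply_left, hI, Finset.sum_insert (by simp), map_add, exch_exch, map_sum, smul_add,
    add_comm (b • f), ← add_assoc]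
  congr 3
  refine Finset.sum_congr rfl fun a ha => ?_
  have ha := Finset.mem_Ioi.1 ha
  rw [exch_apply i j (exch R i a f), rename_exch, Equiv.swap_apply_left,
    Equiv.swap_apply_of_ne_of_ne (by omega) ha.ne']
  rfl

theorem exch_cherednik_right (b : R) {i j : Fin n} (hij : (j : ℕ) = i + 1)
    (f : MvPolynomial (Fin n) R) :
    exch R i j (cherednik b j f) = cherednik b i (exch R i j f) - b • f := by
  have h := exch_cherednik_left b hij (exch R i j f)
  rw [exch_exch] at h
  rw [eq_sub_of_add_eq h.symm, map_sub, exch_exch, map_smul, exch_exch]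

/-- The factor `u + D_i` of the Sekiguchi operator, where `D_i` is the Cherednik operator. -/
noncomputable def sekFactor (b u : R) (i : Fin n) : Module.End R (MvPolynomial (Fin n) R) :=
  u • 1 + cherednik b i

theorem sekFactor_commute (b u v : R) (i j : Fin n) :
    Commute (sekFactor b u i) (sekFactor b v j) :=
  ((Commute.one_left _).smul_left u).add_left
    (((Commute.one_right _).smul_right v).add_right (cherednik_commute b i j))

theorem sekiguchi_eq (b u : R) : sekiguchi n b u = (List.ofFn (sekFactor (n := n) b u)).prod := rfl

theorem sekiguchi_commute (b u v : R) : Commute (sekiguchi n b u) (sekiguchi n b v) := by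
  rw [sekiguchi_eq, sekiguchi_eq]
  refine Commute.list_prod_left _ _ fun x hx => Commute.list_prod_right _ _ fun y hy => ?_
  obtain ⟨i, rfl⟩ := List.mem_ofFn.1 hx
  obtain ⟨j, rfl⟩ := List.mem_ofFn.1 hy
  exact sekFactor_commute b u v i j

theorem sekFactor_pairwise (b u : R) (s : Set (Fin n)) :
    s.Pairwise (Function.onFun Commute (sekFactor b u)) :=
  fun i _ j _ _ => sekFactor_commute b u u i j

theorem sekiguchi_eq_noncommProd (b u : R) {s : Finset (Fin n)} (hs : s = Finset.univ) :
    sekiguchi n b u = s.noncommProd (sekFactor b u) (sekFactor_pairwise b u _) := by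
  obtain rfl : s = (List.finRange n).toFinset := by rw [hs]; ext; simp
  rw [sekiguchi_eq, Finset.noncommProd_toFinset _ _ _ (List.nodup_finRange n), List.ofFn_eq_map]

theorem exch_commute_sekiguchi (b u : R) {i j : Fin n} (hij : (j : ℕ) = i + 1) :
    Commute (exch R i j) (sekiguchi n b u) := by
  have hne : i ≠ j := by intro h; subst h; omega
  have hs : insert i (insert j ((Finset.univ.erase i).erase j)) =
      (Finset.univ : Finset (Fin n)) := by
    ext x; simp; tauto
  rw [sekiguchi_eq_noncommProd b u hs,
    Finset.noncommProd_insert_of_notMem _ _ _ _ (by simp [hne]),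
    Finset.noncommProd_insert_of_notMem _ _ _ _ (by simp), ← mul_assoc]
  refine Commute.mul_right ?_ (Finset.noncommProd_commute _ _ _ _ fun l hl => ?_)
  · -- both factors change by multiples of `b`, and the changes cancel because the factors commute
    refine LinearMap.ext fun f => ?_
    have hc := cherednik_comm_of_lt b (i := i) (j := j) (by rw [Fin.lt_def]; omega) (exch R i j f)
    simp only [sekFactor, Module.End.mul_apply, LinearMap.add_apply, LinearMap.smul_apply,
      Module.End.one_apply, map_add, map_smul, exch_cherednik_left b hij,
      exch_cherednik_right b hij, map_sub]
    simp only [smul_eq_C_mul]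
    linear_combination -hc
  · have h1 : l ≠ j ∧ l ≠ i := by simpa using hl
    refine LinearMap.ext fun f => ?_
    simp [sekFactor, exch_cherednik_of_ne b hij h1.2 h1.1]

end Operators

/-! ### Triangularity -/

section Majorization

/-- The set of the first `t` indices. -/
abbrev initial (n t : ℕ) : Finset (Fin n) := Finset.univ.filter fun i => (i : ℕ) < t

variable {n : ℕ} {lam : Fin n → ℕ}

/-- `Majorizes lam c` says that `c`, once sorted, is dominated by `lam`: every sum of `t` entries
of `c` is at most the sum of the first `t` entries of `lam`. The definition does not sort `c`, and
is visibly invariant under permutations of `c`. -/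
def Majorizes (lam c : Fin n → ℕ) : Prop :=
  ∑ i, c i = ∑ i, lam i ∧
    ∀ T : Finset (Fin n), ∑ i ∈ T, c i ≤ ∑ i ∈ initial n T.card, lam i

theorem Majorizes.comp_perm {c : Fin n → ℕ} (h : Majorizes lam c) (s : Equiv.Perm (Fin n)) :
    Majorizes lam (c ∘ s) := by
  refine ⟨(Equiv.sum_comp s c).trans h.1, fun T => ?_⟩
  have := h.2 (T.map s.toEmbedding)
  simpa using this

/-- Replacing two entries of `a` by entries between them, with the same sum, keeps `a`
majorized. -/
theorem Majorizes.transfer {a c : Fin n → ℕ} (h : Majorizes lam a) {i j : Fin n} (hij : i ≠ j)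
    (hoff : ∀ l, l ≠ i → l ≠ j → c l = a l) (hsum : c i + c j = a i + a j)
    (hi : c i ≤ max (a i) (a j)) (hj : c j ≤ max (a i) (a j)) : Majorizes lam c := by
  have key : ∀ T : Finset (Fin n), (i ∈ T → j ∈ T) → (j ∈ T → i ∈ T) →
      ∑ l ∈ T, c l = ∑ l ∈ T, a l := by
    intro T h1 h2
    by_cases hT : i ∈ T
    · rw [← Finset.add_sum_erase T c hT, ← Finset.add_sum_erase T a hT,
        ← Finset.add_sum_erase _ c (Finset.mem_erase.2 ⟨hij.symm, h1 hT⟩),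
        ← Finset.add_sum_erase _ a (Finset.mem_erase.2 ⟨hij.symm, h1 hT⟩), ← add_assoc, hsum,
        add_assoc]
      congr 2
      refine Finset.sum_congr rfl fun l hl => hoff l ?_ ?_ <;> rintro rfl <;> simp at hl
    · refine Finset.sum_congr rfl fun l hl => hoff l ?_ ?_
      · rintro rfl; exact hT hl
      · rintro rfl; exact hT (h2 hl)
  -- a set containing exactly one of the two indices
  have key2 : ∀ T : Finset (Fin n), ∀ x y : Fin n, x ∈ T → y ∉ T →
      (∀ l, l ≠ x → l ≠ y → c l = a l) → c x ≤ max (a x) (a y) →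
      ∑ l ∈ T, c l ≤ ∑ l ∈ initial n T.card, lam l := by
    intro T x y hx hy hoff' hc
    have e : ∑ l ∈ T.erase x, c l = ∑ l ∈ T.erase x, a l := by
      refine Finset.sum_congr rfl fun l hl => hoff' l (Finset.ne_of_mem_erase hl) ?_
      rintro rfl
      exact hy (Finset.mem_of_mem_erase hl)
    have h1 := h.2 T
    have h2 := h.2 (insert y (T.erase x))
    rw [Finset.sum_insert (by simp [hy]), Finset.card_insert_of_notMem (by simp [hy]),
      Finset.card_erase_of_mem hx, Nat.sub_add_cancel (Finset.card_pos.2 ⟨x, hx⟩)] at h2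
    rw [← Finset.add_sum_erase T _ hx] at h1 ⊢
    omega
  refine ⟨(key _ (by simp) (by simp)).trans h.1, fun T => ?_⟩
  by_cases h1 : i ∈ T <;> by_cases h2 : j ∈ T
  · rw [key T (by simp [h2]) (by simp [h1])]; exact h.2 T
  · exact key2 T i j h1 h2 hoff hi
  · exact key2 T j i h2 h1 (fun l h h' => hoff l h' h) (by rwa [max_comm])
  · rw [key T (by simp [h1]) (by simp [h2])]; exact h.2 T

/-- Compare the sums over the first `i` indices together with `t`. -/
theorem Majorizes.le_of_eq_off {a : Fin n → ℕ} (h : Majorizes lam a) {i j t : Fin n} (hij : i < j)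
    (hoff : ∀ l, l ≠ i → l ≠ j → lam l = a l) (ht : t = i ∨ t = j) : a t ≤ lam i := by
  have hnot : t ∉ Finset.Iio i := by
    rcases ht with rfl | rfl
    · simp
    · simp [hij.le]
  have h1 := h.2 (insert t (Finset.Iio i))
  have hset : initial n (i + 1) =
      insert i (Finset.Iio i) := by
    ext l; simp [le_iff_eq_or_lt, Fin.ext_iff]
  rw [Finset.card_insert_of_notMem hnot, Fin.card_Iio, hset, Finset.sum_insert hnot,
    Finset.sum_insert (by simp)] at h1
  have e : ∑ l ∈ Finset.Iio i, a l = ∑ l ∈ Finset.Iio i, lam l := by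
    refine Finset.sum_congr rfl fun l hl => (hoff l ?_ ?_).symm
    · exact (Finset.mem_Iio.1 hl).ne
    · exact ((Finset.mem_Iio.1 hl).trans hij).ne
  omega

/-- If `a` is majorized by `lam` and differs from it only at `i` and `j`, its entries there are
at most those of `lam`. -/
theorem Majorizes.le_max {a : Fin n → ℕ} (h : Majorizes lam a) {i j : Fin n}
    (hij : i ≠ j) (hoff : ∀ l, l ≠ i → l ≠ j → lam l = a l) : a i ≤ max (lam i) (lam j) := by
  rcases lt_or_gt_of_ne hij with h1 | h1
  · exact (h.le_of_eq_off h1 hoff (Or.inl rfl)).trans (le_max_left _ _)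
  · exact (h.le_of_eq_off h1 (fun l h h' => hoff l h' h) (Or.inr rfl)).trans (le_max_right _ _)

theorem sum_le_sum_initial (hlam : Antitone lam) (T : Finset (Fin n)) :
    ∑ i ∈ T, lam i ≤ ∑ i ∈ initial n T.card, lam i := by
  set I : Finset (Fin n) := initial n T.card with hI
  have hT : T.card ≤ n := by simpa using Finset.card_le_univ T
  have hcard : I.card = T.card := by
    rw [hI, initial, Fin.card_filter_val_lt, min_eq_right hT]
  have hsd : (T \ I).card = (I \ T).card := Finset.card_sdiff_comm hcard.symm
  rw [← Finset.sum_inter_add_sum_sdiff T I, ← Finset.sum_inter_add_sum_sdiff I T,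
    Finset.inter_comm I T]
  refine Nat.add_le_add_left ?_ _
  rcases (T \ I).eq_empty_or_nonempty with h | ⟨x, hx⟩
  · simp [h]
  · have hx' : T.card ≤ x := by simpa [hI] using (Finset.mem_sdiff.1 hx).2
    have hn : T.card < n := lt_of_le_of_lt hx' x.2
    calc ∑ i ∈ T \ I, lam i ≤ (T \ I).card • lam ⟨T.card, hn⟩ := by
          refine Finset.sum_le_card_nsmul _ _ _ fun i hi => hlam ?_
          have : T.card ≤ i := by simpa [hI] using (Finset.mem_sdiff.1 hi).2
          exact this
      _ ≤ ∑ i ∈ I \ T, lam i := by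
          rw [hsd]
          refine Finset.card_nsmul_le_sum _ _ _ fun i hi => hlam ?_
          have : (i : ℕ) < T.card := by simpa [hI] using (Finset.mem_sdiff.1 hi).1
          exact this.le

theorem majorizes_self (hlam : Antitone lam) : Majorizes lam lam :=
  ⟨rfl, sum_le_sum_initial hlam⟩

theorem initial_eq_Iic (i : Fin n) :
    initial n (i + 1) = Finset.Iic i := by
  ext l
  simp only [Finset.mem_filter, Finset.mem_univ, true_and, Finset.mem_Iic, Fin.le_def]
  omega

theorem StrictDom.majorizes {mu : Fin n → ℕ} (hmu : Antitone mu) (h : StrictDom mu lam) :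
    Majorizes lam mu := by
  refine ⟨h.2.1, fun T => (sum_le_sum_initial hmu T).trans ?_⟩
  have hT : T.card ≤ n := by simpa using Finset.card_le_univ T
  rcases Nat.eq_zero_or_pos T.card with h0 | h0
  · simp [h0, initial]
  · have := h.2.2 ⟨T.card - 1, by omega⟩
    rw [← initial_eq_Iic] at this
    simpa [Nat.sub_add_cancel h0] using this

theorem Majorizes.strictDom {mu : Fin n → ℕ} (h : Majorizes lam mu) (hne : mu ≠ lam) :
    StrictDom mu lam := by
  refine ⟨hne, h.1, fun i => ?_⟩
  have := h.2 (Finset.Iic i)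
  rwa [Fin.card_Iic, initial_eq_Iic] at this

theorem eq_of_sum_Iic_eq {mu : Fin n → ℕ}
    (h : ∀ i : Fin n, ∑ j ∈ Finset.Iic i, mu j = ∑ j ∈ Finset.Iic i, lam j) : mu = lam := by
  funext i
  induction i using WellFoundedLT.induction with
  | ind i ih =>
    have h1 := h i
    rw [← Finset.Iio_insert, Finset.sum_insert (by simp), Finset.sum_insert (by simp),
      Finset.sum_congr rfl fun j hj => ih j (Finset.mem_Iio.1 hj)] at h1
    exact Nat.add_right_cancel h1

theorem StrictDom.trans {ka mu : Fin n → ℕ} (h1 : StrictDom ka mu) (h2 : StrictDom mu lam) :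
    StrictDom ka lam := by
  refine ⟨?_, h1.2.1.trans h2.2.1, fun i => (h1.2.2 i).trans (h2.2.2 i)⟩
  rintro rfl
  exact h1.1 (eq_of_sum_Iic_eq fun i => (h1.2.2 i).antisymm (h2.2.2 i))

theorem finite_strictDom (lam : Fin n → ℕ) :
    {mu : Fin n → ℕ | Antitone mu ∧ StrictDom mu lam}.Finite := by
  refine (Set.finite_Iic fun _ : Fin n => ∑ i, lam i).subset fun mu h i => ?_
  rw [← h.2.2.1]
  exact Finset.single_le_sum (f := mu) (fun _ _ => Nat.zero_le _) (Finset.mem_univ i)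

end Majorization

section Triangular

variable {R : Type*} [CommRing R] {n : ℕ}

/-- The polynomials all of whose exponents are majorized by `lam`. -/
noncomputable def majorized (R : Type*) [CommRing R] {n : ℕ} (lam : Fin n → ℕ) :
    Submodule R (MvPolynomial (Fin n) R) :=
  restrictSupport R {a | Majorizes lam a}

/-- `A` is triangular on the polynomials with exponents majorized by `lam`: it preserves them, and
scales the coefficient of the top monomial `x^lam` by `e`. -/
def Triangular (lam : Fin n → ℕ) (A : Module.End R (MvPolynomial (Fin n) R)) (e : R) : Prop :=
  ∀ f ∈ majorized R lam, A f ∈ majorized R lam ∧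
    coeff (Finsupp.equivFunOnFinite.symm lam) (A f) =
      e * coeff (Finsupp.equivFunOnFinite.symm lam) f

theorem monomial_mem_majorized {lam : Fin n → ℕ} {a : Fin n →₀ ℕ} (h : Majorizes lam a) (c : R) :
    monomial a c ∈ majorized R lam := by
  classical
  rw [majorized, mem_restrictSupport_iff]
  intro x hx
  have := support_monomial_subset hx
  simp only [Finset.mem_singleton] at this
  subst this
  exact h

theorem coeff_monomial_one_fun {lam : Fin n → ℕ} (a : Fin n →₀ ℕ) :
    coeff (Finsupp.equivFunOnFinite.symm lam) (monomial a (1 : R)) =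
      if (a : Fin n → ℕ) = lam then 1 else 0 := by
  classical
  rw [coeff_monomial]
  congr 1
  rw [Equiv.eq_symm_apply]
  rfl

namespace Triangular

variable {lam : Fin n → ℕ} {A B : Module.End R (MvPolynomial (Fin n) R)} {e e' : R}

theorem of_monomial (h : ∀ a : Fin n →₀ ℕ, Majorizes lam a →
    A (monomial a 1) ∈ majorized R lam ∧
      coeff (Finsupp.equivFunOnFinite.symm lam) (A (monomial a 1)) =
        e * if (a : Fin n → ℕ) = lam then 1 else 0) : Triangular lam A e := by
  intro f hf
  rw [majorized, restrictSupport_eq_span] at hf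
  induction hf using Submodule.span_induction with
  | mem x hx =>
    obtain ⟨a, ha, rfl⟩ := hx
    rw [coeff_monomial_one_fun]
    exact h a ha
  | zero => simp
  | add x y _ _ hx hy =>
    rw [map_add, coeff_add, coeff_add, hx.2, hy.2, mul_add]
    exact ⟨add_mem hx.1 hy.1, rfl⟩
  | smul c x _ hx =>
    rw [map_smul, coeff_smul, coeff_smul, hx.2]
    exact ⟨Submodule.smul_mem _ _ hx.1, by simp only [smul_eq_mul]; ring⟩

theorem add (hA : Triangular lam A e) (hB : Triangular lam B e') :
    Triangular lam (A + B) (e + e') := fun f hf =>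
  ⟨add_mem (hA f hf).1 (hB f hf).1, by
    rw [LinearMap.add_apply, coeff_add, (hA f hf).2, (hB f hf).2, add_mul]⟩

theorem smul (c : R) (hA : Triangular lam A e) : Triangular lam (c • A) (c * e) := fun f hf =>
  ⟨Submodule.smul_mem _ c (hA f hf).1, by
    rw [LinearMap.smul_apply, coeff_smul, (hA f hf).2, smul_eq_mul, mul_assoc]⟩

theorem one : Triangular lam (1 : Module.End R (MvPolynomial (Fin n) R)) 1 := fun f hf =>
  ⟨hf, by simp⟩

theorem zero : Triangular lam (0 : Module.End R (MvPolynomial (Fin n) R)) 0 := fun f hf =>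
  ⟨by simp, by simp⟩

theorem mul (hA : Triangular lam A e) (hB : Triangular lam B e') :
    Triangular lam (A * B) (e * e') := fun f hf =>
  ⟨(hA _ (hB f hf).1).1, by
    rw [Module.End.mul_apply, (hA _ (hB f hf).1).2, (hB f hf).2, mul_assoc]⟩

theorem sum {ι : Type*} (s : Finset ι) {A : ι → Module.End R (MvPolynomial (Fin n) R)}
    {e : ι → R} (h : ∀ i ∈ s, Triangular lam (A i) (e i)) :
    Triangular lam (∑ i ∈ s, A i) (∑ i ∈ s, e i) := by
  classical
  induction s using Finset.induction_on with
  | empty => simpa using zero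
  | insert a s ha ih =>
    rw [Finset.sum_insert ha, Finset.sum_insert ha]
    exact (h a (by simp)).add (ih fun i hi => h i (by simp [hi]))

theorem list_prod {ι : Type*} (l : List ι) {A : ι → Module.End R (MvPolynomial (Fin n) R)}
    {e : ι → R} (h : ∀ i, Triangular lam (A i) (e i)) :
    Triangular lam (l.map A).prod (l.map e).prod := by
  induction l with
  | nil => simpa using one
  | cons a l ih => simpa using (h a).mul ih

theorem aeval (hA : Triangular lam A e) (q : Polynomial R) :
    Triangular lam (Polynomial.aeval A q) (q.eval e) := by
  induction q using Polynomial.induction_on with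
  | C a => simpa [Algebra.algebraMap_eq_smul_one] using one.smul a
  | add p q hp hq => simpa using hp.add hq
  | monomial k a h => simpa [pow_succ, ← mul_assoc] using h.mul hA

end Triangular

/-- The exponent `a` with `l` units moved from position `i` to position `j`. -/
noncomputable def moveUnits (i j : Fin n) (a : Fin n →₀ ℕ) (l : ℕ) : Fin n →₀ ℕ :=
  (a.update i (a i - l)).update j (a j + l)

theorem moveUnits_left {i j : Fin n} (h : i ≠ j) (a : Fin n →₀ ℕ) (l : ℕ) :
    moveUnits i j a l i = a i - l := by
  simp [moveUnits, h]

theorem moveUnits_right (i j : Fin n) (a : Fin n →₀ ℕ) (l : ℕ) :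
    moveUnits i j a l j = a j + l := by
  simp [moveUnits]

theorem moveUnits_of_ne {i j x : Fin n} (hi : x ≠ i) (hj : x ≠ j) (a : Fin n →₀ ℕ) (l : ℕ) :
    moveUnits i j a l x = a x := by
  simp [moveUnits, hi, hj]

theorem exch_monomial (i j : Fin n) (a : Fin n →₀ ℕ) (c : R) :
    exch R i j (monomial a c) = monomial (a.mapDomain (Equiv.swap i j)) c := by
  rw [exch_apply, rename_monomial]

theorem mapDomain_swap_apply (i j x : Fin n) (a : Fin n →₀ ℕ) :
    a.mapDomain (Equiv.swap i j) x = a (Equiv.swap i j x) := by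
  conv_lhs => rw [← Equiv.swap_apply_self i j x]
  exact Finsupp.mapDomain_apply (Equiv.swap i j).injective a _

theorem mapDomain_swap_coe (i j : Fin n) (a : Fin n →₀ ℕ) :
    (a.mapDomain (Equiv.swap i j) : Fin n → ℕ) = a ∘ Equiv.swap i j :=
  funext fun x => mapDomain_swap_apply i j x a

/-- The degree part `x_i ∂_i` of the Cherednik operator is diagonal. -/
theorem triangular_euler {lam : Fin n → ℕ} (i : Fin n) :
    Triangular lam (LinearMap.mulLeft R (X i) *
      (pderiv (R := R) i : MvPolynomial (Fin n) R →ₗ[R] MvPolynomial (Fin n) R)) (lam i : R) := by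
  refine Triangular.of_monomial fun a ha => ?_
  have : (LinearMap.mulLeft R (X i : MvPolynomial (Fin n) R) *
      (pderiv (R := R) i : MvPolynomial (Fin n) R →ₗ[R] MvPolynomial (Fin n) R)) (monomial a 1) =
        (a i : R) • monomial a (1 : R) := by
    rw [Module.End.mul_apply, LinearMap.mulLeft_apply, Derivation.coeFn_coe, X_mul_pderiv_monomial,
      Nat.cast_smul_eq_nsmul]
  rw [this, coeff_smul, coeff_monomial_one_fun]
  refine ⟨Submodule.smul_mem _ _ (monomial_mem_majorized ha 1), ?_⟩
  split_ifs with h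
  · rw [h]; rfl
  · simp

variable [IsDomain R]

theorem divDiff_exch (i j : Fin n) (f : MvPolynomial (Fin n) R) :
    divDiff R i j (exch R i j f) = - divDiff R i j f := by
  rcases eq_or_ne i j with rfl | h
  · simp [divDiff_self]
  · apply eq_divDiff h
    rw [mul_neg, X_sub_X_mul_divDiff h, exch_exch, neg_sub]

/-- The telescoping expansion of `x_i (x^a - K_ij x^a) / (x_i - x_j)`. -/
theorem X_mul_divDiff_monomial {i j : Fin n} (h : i ≠ j) {a : Fin n →₀ ℕ} (ha : a j ≤ a i) :
    X i * divDiff R i j (monomial a 1) =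
      ∑ l ∈ Finset.range (a i - a j), monomial (moveUnits i j a l) (1 : R) := by
  apply mul_left_cancel₀ (X_sub_X_ne_zero (R := R) h)
  rw [mul_left_comm, X_sub_X_mul_divDiff h, exch_monomial]
  have step : ∀ l ∈ Finset.range (a i - a j),
      (X i - X j) * monomial (moveUnits i j a l) (1 : R) =
        X i * monomial (moveUnits i j a l) (1 : R) -
          X i * monomial (moveUnits i j a (l + 1)) (1 : R) := by
    intro l hl
    rw [sub_mul, sub_right_inj, X, X, monomial_mul, monomial_mul]
    congr 2
    have := Finset.mem_range.1 hl
    ext x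
    rw [Finsupp.add_apply, Finsupp.add_apply]
    rcases eq_or_ne x i with rfl | hi
    · rw [moveUnits_left h, moveUnits_left h, Finsupp.single_eq_same,
        Finsupp.single_eq_of_ne h]
      omega
    · rcases eq_or_ne x j with rfl | hj
      · rw [moveUnits_right, moveUnits_right, Finsupp.single_eq_same,
          Finsupp.single_eq_of_ne hi]
        omega
      · rw [moveUnits_of_ne hi hj, moveUnits_of_ne hi hj, Finsupp.single_eq_of_ne hi,
          Finsupp.single_eq_of_ne hj]
  rw [Finset.mul_sum, Finset.sum_congr rfl step, Finset.sum_range_sub', mul_sub]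
  congr 3
  · congr 1
    ext x
    rcases eq_or_ne x i with rfl | hi
    · rw [moveUnits_left h, Nat.sub_zero]
    · rcases eq_or_ne x j with rfl | hj
      · rw [moveUnits_right, Nat.add_zero]
      · rw [moveUnits_of_ne hi hj]
  · congr 1
    ext x
    rw [mapDomain_swap_apply]
    rcases eq_or_ne x i with rfl | hi
    · rw [moveUnits_left h, Equiv.swap_apply_left]; omega
    · rcases eq_or_ne x j with rfl | hj
      · rw [moveUnits_right, Equiv.swap_apply_right]; omega
      · rw [moveUnits_of_ne hi hj, Equiv.swap_apply_of_ne_of_ne hi hj]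

theorem X_mul_divDiff_monomial_mem {lam : Fin n → ℕ} {i j : Fin n} (h : i ≠ j)
    {a : Fin n →₀ ℕ} (ha : a j ≤ a i) (hm : Majorizes lam a) :
    X i * divDiff R i j (monomial a 1) ∈ majorized R lam := by
  rw [X_mul_divDiff_monomial h ha]
  refine Submodule.sum_mem _ fun l hl => monomial_mem_majorized ?_ 1
  have hl := Finset.mem_range.1 hl
  refine hm.transfer h (fun x hi hj => moveUnits_of_ne hi hj a l) ?_ ?_ ?_
  · rw [moveUnits_left h, moveUnits_right]; omega
  · rw [moveUnits_left h]; omega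
  · rw [moveUnits_right]; omega

/-- Among the exponents in `X_mul_divDiff_monomial` only the first, `a` itself, can be `lam`: for
the others `a` would have an entry too large to be majorized by `lam`. -/
theorem coeff_X_mul_divDiff_monomial {lam : Fin n → ℕ} {i j : Fin n} (h : i ≠ j)
    {a : Fin n →₀ ℕ} (ha : a j ≤ a i) (hm : Majorizes lam a) :
    coeff (Finsupp.equivFunOnFinite.symm lam) (X i * divDiff R i j (monomial a 1)) =
      if (a : Fin n → ℕ) = lam ∧ a j < a i then 1 else 0 := by
  rw [X_mul_divDiff_monomial h ha, coeff_sum]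
  simp only [coeff_monomial_one_fun]
  have h0 : ∀ l < a i - a j, (moveUnits i j a l : Fin n → ℕ) = lam → l = 0 := by
    intro l hl he
    have h1 := hm.le_max h (fun x hi hj => by rw [← he, moveUnits_of_ne hi hj])
    rw [← he, moveUnits_left h, moveUnits_right] at h1
    omega
  have h1 : (moveUnits i j a 0 : Fin n → ℕ) = a := by
    ext x
    rcases eq_or_ne x i with rfl | hi
    · rw [moveUnits_left h, Nat.sub_zero]
    · rcases eq_or_ne x j with rfl | hj
      · rw [moveUnits_right, Nat.add_zero]
      · rw [moveUnits_of_ne hi hj]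
  rcases ha.eq_or_lt with h2 | h2
  · simp [h2]
  · rw [Finset.sum_eq_single 0, h1]
    · simp [h2]
    · intro l hl hl0
      rw [if_neg fun he => hl0 (h0 l (Finset.mem_range.1 hl) he)]
    · intro hn
      simp at hn
      omega

/-- Each two-variable part of the Cherednik operator is triangular. The coefficient of `x^lam` that
the divided difference sends to it from `x^(K_ij lam)` is cancelled by that of `K_ij`. -/
theorem triangular_pair {lam : Fin n → ℕ} (hlam : Antitone lam) {i j : Fin n} (h : i ≠ j) :
    Triangular lam (LinearMap.mulLeft R (X i) * divDiff R i j +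
      if i < j then exch R i j else 0) (if i < j then 1 else 0) := by
  refine Triangular.of_monomial fun a ha => ?_
  have hK : Majorizes lam (a.mapDomain (Equiv.swap i j)) := by
    rw [mapDomain_swap_coe]; exact ha.comp_perm _
  have hKi : a.mapDomain (Equiv.swap i j) i = a j := by
    rw [mapDomain_swap_apply, Equiv.swap_apply_left]
  have hKj : a.mapDomain (Equiv.swap i j) j = a i := by
    rw [mapDomain_swap_apply, Equiv.swap_apply_right]
  have hmem : (if i < j then exch R i j else 0) (monomial a 1) ∈ majorized R lam := by
    split_ifs
    · rw [exch_monomial]; exact monomial_mem_majorized hK 1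
    · simp
  have hcoe : coeff (Finsupp.equivFunOnFinite.symm lam)
      ((if i < j then exch R i j else 0) (monomial a 1)) =
        if i < j ∧ (a.mapDomain (Equiv.swap i j) : Fin n → ℕ) = lam then 1 else 0 := by
    by_cases hij : i < j
    · simp only [hij, if_true, true_and]
      rw [exch_monomial, coeff_monomial_one_fun]
    · simp [hij]
  rw [LinearMap.add_apply, coeff_add, hcoe, Module.End.mul_apply, LinearMap.mulLeft_apply]
  rcases le_or_gt (a j) (a i) with hle | hlt
  · refine ⟨add_mem (X_mul_divDiff_monomial_mem h hle ha) hmem, ?_⟩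
    rw [coeff_X_mul_divDiff_monomial h hle ha]
    rcases hle.eq_or_lt with heq | hlt
    · have : (a.mapDomain (Equiv.swap i j) : Fin n → ℕ) = a := by
        funext x
        rw [mapDomain_swap_apply, Equiv.swap_apply_def]
        split_ifs with h1 h2
        · rw [h1, heq]
        · rw [h2, heq]
        · rfl
      rw [this]
      by_cases h1 : i < j <;> simp [h1, heq]
    · by_cases hij : i < j
      · rw [if_neg (c := i < j ∧ _)]
        · simp [hij, hlt]
        · rintro ⟨_, he⟩
          have := hlam hij.le
          rw [← he, hKi, hKj] at this
          omega
      · rw [if_neg (c := _ ∧ a j < a i)]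
        · simp [hij]
        · rintro ⟨he, _⟩
          have := hlam (le_of_not_gt hij)
          rw [← he] at this
          omega
  · have hX : X i * divDiff R i j (monomial a 1) =
        - (X i * divDiff R i j (monomial (a.mapDomain (Equiv.swap i j)) 1)) := by
      rw [← exch_monomial, divDiff_exch, mul_neg, neg_neg]
    have hle : a.mapDomain (Equiv.swap i j) j ≤ a.mapDomain (Equiv.swap i j) i := by
      rw [hKi, hKj]; exact hlt.le
    rw [hX]
    refine ⟨add_mem (neg_mem (X_mul_divDiff_monomial_mem h hle hK)) hmem, ?_⟩
    rw [coeff_neg, coeff_X_mul_divDiff_monomial h hle hK, hKi, hKj]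
    by_cases hij : i < j
    · rw [if_neg (c := (a : Fin n → ℕ) = lam)]
      · simp [hij, hlt]
      · intro he
        have := hlam hij.le
        rw [← he] at this
        omega
    · rw [if_neg (c := _ ∧ a i < a j)]
      · simp [hij]
      · rintro ⟨he, _⟩
        have := hlam (le_of_not_gt hij)
        rw [← he, hKi, hKj] at this
        omega

theorem triangular_cherednik {lam : Fin n → ℕ} (hlam : Antitone lam) (b : R) (i : Fin n) :
    Triangular lam (cherednik b i) (lam i + ((n : R) - ((i : ℕ) + 1)) * b) := by
  have h := (triangular_euler (R := R) (lam := lam) i).add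
    ((Triangular.sum (Finset.univ.erase i) (fun j hj =>
      triangular_pair (R := R) hlam (Finset.ne_of_mem_erase hj).symm)).smul b)
  have hset : (Finset.univ.erase i).filter (fun j => i < j) = Finset.Ioi i := by
    ext j; simp only [Finset.mem_filter, Finset.mem_erase, Finset.mem_univ, Finset.mem_Ioi]
    exact ⟨fun h => h.2, fun h => ⟨⟨h.ne', trivial⟩, h⟩⟩
  convert h using 1
  · rw [Finset.sum_add_distrib, ← Finset.sum_filter, hset, cherednik, dunkl, mul_add,
      ← Finset.mul_sum, smul_add, mul_smul_comm, add_assoc]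
  · rw [← Finset.sum_filter, hset, Finset.sum_const, Fin.card_Ioi, nsmul_eq_mul, mul_one, mul_comm,
      Nat.sub_sub, Nat.cast_sub (by omega)]
    push_cast
    ring

theorem triangular_sekiguchi {lam : Fin n → ℕ} (hlam : Antitone lam) (b u : R) :
    Triangular lam (sekiguchi n b u) (eigenvalue b u lam) := by
  have h := Triangular.list_prod (List.finRange n) (lam := lam) (A := sekFactor b u)
    (e := fun i => u * 1 + (lam i + ((n : R) - ((i : ℕ) + 1)) * b))
    (fun i => (Triangular.one.smul u).add (triangular_cherednik hlam b i))
  rw [sekiguchi_eq, List.ofFn_eq_map]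
  convert h using 1
  rw [eigenvalue, ← List.ofFn_eq_map, List.prod_ofFn]
  exact Finset.prod_congr rfl fun i _ => by ring

end Triangular

/-! ### Symmetric polynomials and the eigenvector -/

section Symmetric

variable {R : Type*} [CommRing R] {n : ℕ}

theorem exists_antitone_comp (a : Fin n → ℕ) : ∃ s : Equiv.Perm (Fin n), Antitone (a ∘ s) :=
  ⟨Fin.revPerm.trans (Tuple.sort a), fun _ _ h => Tuple.monotone_sort a (Fin.rev_le_rev.2 h)⟩

theorem eq_of_antitone_comp_perm {mu c : Fin n → ℕ} (hmu : Antitone mu) (hc : Antitone c)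
    {s : Equiv.Perm (Fin n)} (h : mu ∘ s = c) : mu = c := by
  rw [← h] at hc ⊢
  exact Tuple.unique_antitone (σ := 1) (τ := s) hmu hc

theorem coeff_comp_perm {f : MvPolynomial (Fin n) R} (hf : f.IsSymmetric) (a : Fin n → ℕ)
    (s : Equiv.Perm (Fin n)) :
    coeff (Finsupp.equivFunOnFinite.symm (a ∘ s)) f =
      coeff (Finsupp.equivFunOnFinite.symm a) f := by
  conv_rhs => rw [← hf s⁻¹.symm]
  have : Finsupp.equivFunOnFinite.symm a =
      (Finsupp.equivFunOnFinite.symm (a ∘ s)).mapDomain s := by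
    ext x
    conv_rhs => rw [← s.apply_symm_apply x]
    rw [Finsupp.mapDomain_apply s.injective]
    simp
  rw [this]
  exact (coeff_rename_mapDomain s s.injective f _).symm

/-- A symmetric polynomial is determined by its coefficients at partitions. -/
theorem eq_of_coeff_antitone {f g : MvPolynomial (Fin n) R} (hf : f.IsSymmetric)
    (hg : g.IsSymmetric) (h : ∀ c : Fin n → ℕ, Antitone c →
      coeff (Finsupp.equivFunOnFinite.symm c) f = coeff (Finsupp.equivFunOnFinite.symm c) g) :
    f = g := by
  ext a
  obtain ⟨s, hs⟩ := exists_antitone_comp a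
  have := h _ hs
  rw [coeff_comp_perm hf, coeff_comp_perm hg] at this
  simpa using this

theorem coeff_monSymm (mu c : Fin n → ℕ) [Decidable (∃ s : Equiv.Perm (Fin n), mu ∘ s = c)] :
    coeff (Finsupp.equivFunOnFinite.symm c) (monSymm R mu) =
      if ∃ s : Equiv.Perm (Fin n), mu ∘ s = c then 1 else 0 := by
  have e : ∀ a : Fin n → ℕ, coeff (Finsupp.equivFunOnFinite.symm c)
      (monomial (Finsupp.equivFunOnFinite.symm a) (1 : R)) = if a = c then 1 else 0 := fun a =>
    (coeff_monomial_one_fun _).trans (if_congr Iff.rfl rfl rfl)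
  rw [monSymm, coeff_sum, Finset.sum_congr rfl fun a _ => e a, Finset.sum_ite_eq']
  simp

theorem coeff_monSymm_antitone {mu c : Fin n → ℕ} (hmu : Antitone mu) (hc : Antitone c) :
    coeff (Finsupp.equivFunOnFinite.symm c) (monSymm R mu) = if mu = c then 1 else 0 := by
  classical
  rw [coeff_monSymm]
  congr 1
  exact propext ⟨fun ⟨s, hs⟩ => eq_of_antitone_comp_perm hmu hc hs, fun h => ⟨1, h⟩⟩

theorem monSymm_isSymmetric (mu : Fin n → ℕ) : (monSymm R mu).IsSymmetric := by
  classical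
  intro s
  rw [monSymm, map_sum]
  refine Finset.sum_bij (fun a _ => a ∘ s.symm) (fun a ha => ?_) (fun a _ a' _ h => ?_)
    (fun a ha => ?_) fun a ha => ?_
  · obtain ⟨t, _, rfl⟩ := Finset.mem_image.1 ha
    exact Finset.mem_image.2 ⟨s.symm.trans t, Finset.mem_univ _, rfl⟩
  · exact s.symm.surjective.injective_comp_right h
  · obtain ⟨t, _, rfl⟩ := Finset.mem_image.1 ha
    refine ⟨mu ∘ (s.trans t), Finset.mem_image_of_mem _ (Finset.mem_univ _), ?_⟩
    ext x; simp
  · rw [rename_monomial]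
    congr 2
    ext x
    conv_lhs => rw [← s.apply_symm_apply x]
    rw [Finsupp.mapDomain_apply s.injective]
    simp

/-- The symmetric polynomials all of whose exponents are majorized by `lam`. -/
noncomputable def symMajorized (R : Type*) [CommRing R] {n : ℕ} (lam : Fin n → ℕ) :
    Submodule R (MvPolynomial (Fin n) R) :=
  majorized R lam ⊓ (symmetricSubalgebra (Fin n) R).toSubmodule

/-- The span of the monomial symmetric polynomials of the partitions strictly below `lam`. -/
noncomputable def lower (R : Type*) [CommRing R] {n : ℕ} (lam : Fin n → ℕ) :
    Submodule R (MvPolynomial (Fin n) R) :=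
  Submodule.span R {p | ∃ mu : Fin n → ℕ, Antitone mu ∧ StrictDom mu lam ∧ p = monSymm R mu}

variable {lam : Fin n → ℕ}

theorem monSymm_mem {mu : Fin n → ℕ} (h : Majorizes lam mu) :
    monSymm R mu ∈ symMajorized R lam := by
  refine ⟨Submodule.sum_mem _ fun a ha => ?_, monSymm_isSymmetric mu⟩
  obtain ⟨s, _, rfl⟩ := Finset.mem_image.1 ha
  exact monomial_mem_majorized (by simpa using h.comp_perm s) 1

theorem lower_le_symMajorized : lower R lam ≤ symMajorized R lam := by
  rw [lower, Submodule.span_le]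
  rintro _ ⟨mu, hmu, h, rfl⟩
  exact monSymm_mem (h.majorizes hmu)

/-- A symmetric polynomial with exponents majorized by `lam` and no term `x^lam` is a combination of
the `m_mu` with `mu < lam`. -/
theorem mem_lower {f : MvPolynomial (Fin n) R} (hf : f ∈ symMajorized R lam)
    (h0 : coeff (Finsupp.equivFunOnFinite.symm lam) f = 0) : f ∈ lower R lam := by
  classical
  set N := (finite_strictDom lam).toFinset with hN
  have hsum : ∑ mu ∈ N, coeff (Finsupp.equivFunOnFinite.symm mu) f • monSymm R mu ∈
      lower R lam := by
    refine Submodule.sum_mem _ fun mu hmu => Submodule.smul_mem _ _ (Submodule.subset_span ?_)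
    rw [hN, Set.Finite.mem_toFinset] at hmu
    exact ⟨mu, hmu.1, hmu.2, rfl⟩
  convert hsum using 1
  refine eq_of_coeff_antitone hf.2 (lower_le_symMajorized hsum).2 fun c hc => ?_
  have e : ∀ mu ∈ N, coeff (Finsupp.equivFunOnFinite.symm c)
      (coeff (Finsupp.equivFunOnFinite.symm mu) f • monSymm R mu) =
        if mu = c then coeff (Finsupp.equivFunOnFinite.symm mu) f else 0 := by
    intro mu hmu
    rw [hN, Set.Finite.mem_toFinset] at hmu
    rw [coeff_smul, coeff_monSymm_antitone hmu.1 hc, smul_eq_mul, mul_ite, mul_one, mul_zero]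
  rw [coeff_sum, Finset.sum_congr rfl e, Finset.sum_ite_eq']
  split_ifs with hcN
  · rfl
  · by_cases hcl : c = lam
    · rw [hcl, h0]
    · by_contra hne
      have hmaj : Majorizes lam c := by
        have := (mem_restrictSupport_iff R).1 hf.1 (mem_support_iff.2 hne)
        simpa using this
      exact hcN (by rw [hN, Set.Finite.mem_toFinset]; exact ⟨hc, hmaj.strictDom hcl⟩)

/-- Invariance under the adjacent transpositions is enough for symmetry. -/
theorem isSymmetric_of_exch {f : MvPolynomial (Fin n) R}
    (h : ∀ i j : Fin n, (j : ℕ) = i + 1 → exch R i j f = f) : f.IsSymmetric := by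
  obtain _ | n := n
  · intro s
    rw [Subsingleton.elim s 1]
    exact rename_id_apply f
  · let M : Submonoid (Equiv.Perm (Fin (n + 1))) :=
      { carrier := {s | rename s f = f}
        one_mem' := rename_id_apply f
        mul_mem' := fun {s t} hs ht => by
          change rename (s ∘ t) f = f
          rw [← rename_rename, show rename t f = f from ht, show rename s f = f from hs] }
    have hM : M = ⊤ := by
      rw [← top_le_iff, ← Equiv.Perm.mclosure_swap_castSucc_succ, Submonoid.closure_le]
      rintro _ ⟨i, rfl⟩
      exact h i.castSucc i.succ (by simp)
    intro s
    have : s ∈ M := hM ▸ Submonoid.mem_top s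
    exact this

variable [IsDomain R]

theorem sekiguchi_mem (hlam : Antitone lam) (b u : R) {f : MvPolynomial (Fin n) R}
    (hf : f ∈ symMajorized R lam) : sekiguchi n b u f ∈ symMajorized R lam := by
  refine ⟨(triangular_sekiguchi hlam b u f hf.1).1, isSymmetric_of_exch fun i j hij => ?_⟩
  have h : exch R i j f = f := hf.2 (Equiv.swap i j)
  have := LinearMap.congr_fun (exch_commute_sekiguchi (n := n) b u hij) f
  rwa [Module.End.mul_apply, Module.End.mul_apply, h] at this

theorem sekiguchi_sub_mem_lower (hlam : Antitone lam) (b u : R) {f : MvPolynomial (Fin n) R}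
    (hf : f ∈ symMajorized R lam) :
    sekiguchi n b u f - eigenvalue b u lam • f ∈ lower R lam := by
  refine mem_lower (sub_mem (sekiguchi_mem hlam b u hf) (Submodule.smul_mem _ _ hf)) ?_
  rw [coeff_sub, (triangular_sekiguchi hlam b u f hf.1).2, coeff_smul, smul_eq_mul, sub_self]

end Symmetric

section Eigenvector

variable {F : Type*} [Field F] {n : ℕ}

/-- The polynomial whose roots are the eigenvalues of `S(u, b)` at the partitions strictly below
`lam`. -/
noncomputable def lowerPoly (b u : F) (lam : Fin n → ℕ) : Polynomial F :=
  ∏ mu ∈ (finite_strictDom lam).toFinset, (Polynomial.X - Polynomial.C (eigenvalue b u mu))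

theorem aeval_sekiguchi_mem {lam : Fin n → ℕ} (hlam : Antitone lam) (b u : F) (q : Polynomial F)
    {f : MvPolynomial (Fin n) F} (hf : f ∈ symMajorized F lam) :
    Polynomial.aeval (sekiguchi n b u) q f ∈ symMajorized F lam := by
  induction q using Polynomial.induction_on generalizing f with
  | C a => simpa [Algebra.algebraMap_eq_smul_one] using Submodule.smul_mem _ a hf
  | add p q hp hq => simpa using add_mem (hp hf) (hq hf)
  | monomial k a h =>
    rw [pow_succ, ← mul_assoc, map_mul, Polynomial.aeval_X, Module.End.mul_apply]
    exact h (sekiguchi_mem hlam b u hf)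

/-- By induction on the number of partitions below: `S(u, b)` minus the eigenvalue at `mu` sends
`m_mu` to the span of lower terms, which the remaining factors kill. -/
theorem aeval_lowerPoly_eq_zero (b u : F) (lam : Fin n → ℕ) {f : MvPolynomial (Fin n) F}
    (hf : f ∈ lower F lam) :
    Polynomial.aeval (sekiguchi n b u) (lowerPoly b u lam) f = 0 := by
  classical
  induction hc : (finite_strictDom lam).toFinset.card using Nat.strong_induction_on
    generalizing lam f with
  | _ c ih =>
  induction hf using Submodule.span_induction with
  | mem x hx =>
    obtain ⟨mu, hmu, h, rfl⟩ := hx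
    have hnot : mu ∉ (finite_strictDom mu).toFinset := by
      rw [Set.Finite.mem_toFinset]; exact fun hh => hh.2.1 rfl
    have hsub : insert mu (finite_strictDom mu).toFinset ⊆ (finite_strictDom lam).toFinset := by
      intro ka hka
      rw [Set.Finite.mem_toFinset]
      rcases Finset.mem_insert.1 hka with rfl | hka
      · exact ⟨hmu, h⟩
      · rw [Set.Finite.mem_toFinset] at hka
        exact ⟨hka.1, hka.2.trans h⟩
    -- the factors at `mu` and below it are among those of `lowerPoly b u lam`
    have hdvd : (lowerPoly b u mu) * (Polynomial.X - Polynomial.C (eigenvalue b u mu)) ∣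
        lowerPoly b u lam := by
      rw [mul_comm, lowerPoly, ← Finset.prod_insert (f := fun mu =>
        Polynomial.X - Polynomial.C (eigenvalue b u mu)) hnot]
      exact Finset.prod_dvd_prod_of_subset _ _ _ hsub
    obtain ⟨q, hq⟩ := hdvd
    have hlt : (finite_strictDom mu).toFinset.card < c := by
      rw [← hc]
      exact lt_of_lt_of_le (by rw [Finset.card_insert_of_notMem hnot]; omega)
        (Finset.card_le_card hsub)
    have h0 := ih _ hlt mu (sekiguchi_sub_mem_lower hmu b u (monSymm_mem (majorizes_self hmu))) rfl
    rw [hq, mul_comm, map_mul, map_mul, Module.End.mul_apply, Module.End.mul_apply]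
    rw [map_sub, Polynomial.aeval_X, Polynomial.aeval_C, LinearMap.sub_apply,
      Module.algebraMap_end_apply, h0, map_zero]
  | zero => simp
  | add x y _ _ hx hy => rw [map_add, hx, hy, add_zero]
  | smul c x _ hx => rw [map_smul, hx, smul_zero]

theorem eval_lowerPoly_ne_zero {b u : F} {lam : Fin n → ℕ}
    (h : ∀ mu, Antitone mu → StrictDom mu lam → eigenvalue b u lam ≠ eigenvalue b u mu) :
    (lowerPoly b u lam).eval (eigenvalue b u lam) ≠ 0 := by
  rw [lowerPoly, Polynomial.eval_prod, Finset.prod_ne_zero_iff]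
  intro mu hmu
  rw [Set.Finite.mem_toFinset] at hmu
  simpa [sub_eq_zero] using h mu hmu.1 hmu.2

theorem aeval_apply_of_eigen {M : Type*} [AddCommGroup M] [Module F M] {A : Module.End F M} {e : F}
    {v : M} (h : A v = e • v) (q : Polynomial F) : Polynomial.aeval A q v = q.eval e • v := by
  rcases eq_or_ne v 0 with rfl | hv
  · simp
  · exact Module.End.aeval_apply_of_hasEigenvector ⟨Module.End.mem_eigenspace_iff.2 h, hv⟩

/-- When the eigenvalue at `lam` is separated from those below it, `S(u, b)` has no eigenvector
for that eigenvalue among the lower terms. -/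
theorem eq_zero_of_mem_lower {b u : F} {lam : Fin n → ℕ}
    (h : ∀ mu, Antitone mu → StrictDom mu lam → eigenvalue b u lam ≠ eigenvalue b u mu)
    {f : MvPolynomial (Fin n) F} (hf : f ∈ lower F lam)
    (he : sekiguchi n b u f = eigenvalue b u lam • f) : f = 0 := by
  have h1 := aeval_lowerPoly_eq_zero b u lam hf
  rw [aeval_apply_of_eigen he] at h1
  exact (smul_eq_zero.1 h1).resolve_left (eval_lowerPoly_ne_zero h)

/-- The spectral projection of `m_lam` onto the eigenspace of `S(u, b)` at `lam`. -/
noncomputable def jackProj (b u : F) (lam : Fin n → ℕ) : MvPolynomial (Fin n) F :=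
  ((lowerPoly b u lam).eval (eigenvalue b u lam))⁻¹ •
    Polynomial.aeval (sekiguchi n b u) (lowerPoly b u lam) (monSymm F lam)

theorem coeff_monSymm_self {R : Type*} [CommRing R] {lam : Fin n → ℕ} (hlam : Antitone lam) :
    coeff (Finsupp.equivFunOnFinite.symm lam) (monSymm R lam) = 1 := by
  rw [coeff_monSymm_antitone hlam hlam, if_pos rfl]

theorem jackProj_sub_mem {b u : F} {lam : Fin n → ℕ} (hlam : Antitone lam)
    (h : ∀ mu, Antitone mu → StrictDom mu lam → eigenvalue b u lam ≠ eigenvalue b u mu) :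
    jackProj b u lam - monSymm F lam ∈ lower F lam := by
  have hm : monSymm F lam ∈ symMajorized F lam := monSymm_mem (majorizes_self hlam)
  refine mem_lower (sub_mem (Submodule.smul_mem _ _ (aeval_sekiguchi_mem hlam b u _ hm)) hm) ?_
  rw [coeff_sub, jackProj, coeff_smul, ((triangular_sekiguchi hlam b u).aeval _ _ hm.1).2,
    coeff_monSymm_self hlam, mul_one, smul_eq_mul, inv_mul_cancel₀ (eval_lowerPoly_ne_zero h),
    sub_self]

/-- The projection is an eigenvector of all `S(v, b)`, because these commute with `S(u, b)`. -/
theorem sekiguchi_jackProj {b u : F} {lam : Fin n → ℕ} (hlam : Antitone lam)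
    (h : ∀ mu, Antitone mu → StrictDom mu lam → eigenvalue b u lam ≠ eigenvalue b u mu) (v : F) :
    sekiguchi n b v (jackProj b u lam) = eigenvalue b v lam • jackProj b u lam := by
  have hm : monSymm F lam ∈ symMajorized F lam := monSymm_mem (majorizes_self hlam)
  have hu : sekiguchi n b u (jackProj b u lam) = eigenvalue b u lam • jackProj b u lam := by
    have h0 := aeval_lowerPoly_eq_zero b u lam (sekiguchi_sub_mem_lower hlam b u hm)
    have hc : Commute (sekiguchi n b u)
        (Polynomial.aeval (sekiguchi n b u) (lowerPoly b u lam)) := by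
      have := (Polynomial.commute_X (lowerPoly b u lam)).map
        (Polynomial.aeval (R := F) (sekiguchi n b u))
      simpa using this
    rw [map_sub, map_smul, sub_eq_zero] at h0
    rw [jackProj, map_smul, ← Module.End.mul_apply, hc.eq, Module.End.mul_apply, h0, smul_comm]
  have hP : jackProj b u lam ∈ symMajorized F lam :=
    Submodule.smul_mem _ _ (aeval_sekiguchi_mem hlam b u _ hm)
  rw [← sub_eq_zero]
  refine eq_zero_of_mem_lower h (sekiguchi_sub_mem_lower hlam b v hP) ?_
  have hcomm := LinearMap.congr_fun (sekiguchi_commute (n := n) b u v) (jackProj b u lam)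
  rw [Module.End.mul_apply, Module.End.mul_apply] at hcomm
  rw [map_sub, hcomm, hu, map_smul, map_smul, hu, smul_sub, smul_comm (eigenvalue b v lam)]

end Eigenvector

/-! ### Separation of eigenvalues and regularity -/

section Separation

variable {n : ℕ}

theorem exists_perm_of_map_univ_eq {α : Type*} {f g : Fin n → α}
    (h : (Finset.univ : Finset (Fin n)).val.map f = (Finset.univ : Finset (Fin n)).val.map g) :
    ∃ s : Equiv.Perm (Fin n), ∀ i, f i = g (s i) := by
  classical
  have hc : ∀ c, Nonempty ({i // f i = c} ≃ {i // g i = c}) := fun c => by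
    refine Fintype.card_eq.1 ?_
    have := congrArg (Multiset.count c) h
    rw [Multiset.count_map, Multiset.count_map] at this
    rw [Fintype.card_subtype, Fintype.card_subtype, Finset.card_def, Finset.card_def,
      Finset.filter_val, Finset.filter_val]
    simpa only [eq_comm] using this
  exact ⟨Equiv.ofFiberEquiv fun c => (hc c).some, fun i => (Equiv.ofFiberEquiv_map _ i).symm⟩

/-- The eigenvalue of the Sekiguchi operator as a polynomial in `u`. -/
noncomputable def eigenPoly (b : ℂ) (lam : Fin n → ℕ) : Polynomial ℂ :=
  ∏ i : Fin n, (Polynomial.X - Polynomial.C (-((lam i : ℂ) + ((n : ℂ) - ((i : ℕ) + 1)) * b)))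

theorem eval_eigenPoly (b u : ℂ) (lam : Fin n → ℕ) :
    (eigenPoly b lam).eval u = eigenvalue b u lam := by
  rw [eigenPoly, Polynomial.eval_prod, eigenvalue]
  refine Finset.prod_congr rfl fun i _ => ?_
  simp only [Polynomial.eval_sub, Polynomial.eval_X, Polynomial.eval_C]
  ring

/-- Equal eigenvalue polynomials have the same roots with multiplicity. -/
theorem exists_perm_of_eigenPoly_eq {b : ℂ} {mu lam : Fin n → ℕ}
    (h : eigenPoly b mu = eigenPoly b lam) :
    ∃ s : Equiv.Perm (Fin n), ∀ i,
      (mu i : ℂ) - lam (s i) = (((i : ℕ) : ℂ) - ((s i : ℕ) : ℂ)) * b := by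
  have hr : ∀ ka : Fin n → ℕ, (eigenPoly b ka).roots = (Finset.univ : Finset (Fin n)).val.map
      fun i => -((ka i : ℂ) + ((n : ℂ) - ((i : ℕ) + 1)) * b) := fun ka => by
    have := Polynomial.roots_multiset_prod_X_sub_C ((Finset.univ : Finset (Fin n)).val.map
      fun i => -((ka i : ℂ) + ((n : ℂ) - ((i : ℕ) + 1)) * b))
    rw [Multiset.map_map] at this
    exact this
  have h2 := congrArg Polynomial.roots h
  rw [hr, hr] at h2
  obtain ⟨s, hs⟩ := exists_perm_of_map_univ_eq h2
  exact ⟨s, fun i => by linear_combination -hs i⟩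

/-- A partition one node away from an admissible one violates admissibility at most at one index,
and there by at most one. For a node added in row `s < k` there is no violation, and the truncated
`s - k = 0` is harmless. -/
theorem exists_gap {k r : ℕ} (hk : 1 ≤ k) {mu lam : Fin n → ℕ} (hmu : Admissible k r mu)
    (h : AddNode mu lam ∨ AddNode lam mu ∨ lam = mu) :
    ∃ a : ℕ, ∀ i j : Fin n, (j : ℕ) = i + k → lam j + r ≤ lam i + if (i : ℕ) = a then 1 else 0 := by
  rcases h with ⟨s, rfl⟩ | ⟨s, rfl⟩ | rfl
  · refine ⟨s - k, fun i j hij => ?_⟩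
    have h1 := hmu.2 i j hij
    have hi : (i : ℕ) = s → mu i = mu s := fun e => by rw [Fin.ext e]
    have hj : (j : ℕ) = s → mu j = mu s := fun e => by rw [Fin.ext e]
    simp only [Function.update_apply, Fin.ext_iff]
    split_ifs <;> omega
  · refine ⟨s, fun i j hij => ?_⟩
    have h1 := hmu.2 i j hij
    have hi : (i : ℕ) = s → lam i = lam s := fun e => by rw [Fin.ext e]
    have hj : (j : ℕ) = s → lam j = lam s := fun e => by rw [Fin.ext e]
    simp only [Function.update_apply, Fin.ext_iff] at h1
    split_ifs at h1 ⊢ <;> omega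
  · exact ⟨0, fun i j hij => (hmu.2 i j hij).trans (Nat.le_add_right _ _)⟩

/-- At `β = -(r-1)/(k+1)` the eigenvalue determines the partition, among those of the same size,
if the differences `lam_i - lam_{i+k}` are large enough. -/
theorem eq_of_eigenPoly_eq {k r a : ℕ} (hk : 1 ≤ k) (hr : 1 ≤ r)
    (hkr : Nat.Coprime (k + 1) (r - 1)) {mu lam : Fin n → ℕ} (hlam : Antitone lam)
    (gap : ∀ i j : Fin n, (j : ℕ) = i + k → lam j + r ≤ lam i + if (i : ℕ) = a then 1 else 0)
    (hmu : Antitone mu) (hsum : ∑ i, mu i = ∑ i, lam i)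
    (h : eigenPoly (-((r : ℂ) - 1) / ((k : ℂ) + 1)) mu =
      eigenPoly (-((r : ℂ) - 1) / ((k : ℂ) + 1)) lam) : mu = lam := by
  obtain ⟨s, hs⟩ := exists_perm_of_eigenPoly_eq h
  have hext : ∀ ka : Fin n → ℕ, Antitone ka → ∀ i j, i ≤ j → j < n →
      (if h : j < n then (ka ⟨j, h⟩ : ℤ) else 0) ≤ if h : i < n then (ka ⟨i, h⟩ : ℤ) else 0 := by
    intro ka hka i j hij hj
    rw [dif_pos hj, dif_pos (hij.trans_lt hj)]
    exact_mod_cast hka hij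
  have key := eq_of_shifted_perm (n := n) (k := k) (a := a) (r := r) hk
    (L := fun q => if h : q < n then (lam ⟨q, h⟩ : ℤ) else 0)
    (N := fun q => if h : q < n then (mu ⟨q, h⟩ : ℤ) else 0) (hext lam hlam) (hext mu hmu)
    (fun i hi => by
      rw [dif_pos hi, dif_pos (by omega)]
      have := gap ⟨i, by omega⟩ ⟨i + k, hi⟩ rfl
      exact_mod_cast this)
    (w := fun q => if h : q < n then (s ⟨q, h⟩ : ℕ) else 0)
    (fun q hq => by rw [dif_pos hq]; exact (s ⟨q, hq⟩).2)
    (fun p hp q hq hpq => by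
      rw [dif_pos hp, dif_pos hq] at hpq
      simpa using s.injective (Fin.ext hpq))
    (fun q hq => by
      rw [dif_pos hq, dif_pos hq, dif_pos (s ⟨q, hq⟩).2]
      simp only [Fin.eta]
      have h1 := hs ⟨q, hq⟩
      have hk0 : (k : ℂ) + 1 ≠ 0 := by exact_mod_cast Nat.succ_ne_zero k
      field_simp at h1
      have h2 : ((k : ℤ) + 1) * ((mu ⟨q, hq⟩ : ℤ) - lam (s ⟨q, hq⟩)) =
          ((r : ℤ) - 1) * (((s ⟨q, hq⟩ : ℕ) : ℤ) - q) := by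
        have : (((((k : ℤ) + 1) * ((mu ⟨q, hq⟩ : ℤ) - lam (s ⟨q, hq⟩)) : ℤ)) : ℂ) =
            ((((r : ℤ) - 1) * (((s ⟨q, hq⟩ : ℕ) : ℤ) - q) : ℤ) : ℂ) := by
          push_cast
          linear_combination h1
        exact_mod_cast this
      have hcop : IsCoprime ((k : ℤ) + 1) ((r : ℤ) - 1) := by
        have := Nat.isCoprime_iff_coprime.2 hkr
        rwa [Nat.cast_sub hr, Nat.cast_succ, Nat.cast_one] at this
      obtain ⟨m, hm⟩ := hcop.dvd_of_dvd_mul_left ⟨_, h2.symm⟩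
      refine ⟨m, by linarith, ?_⟩
      have hk1 : (k : ℤ) + 1 ≠ 0 := by omega
      rw [hm] at h2
      have := mul_left_cancel₀ hk1 (h2.trans (by ring : _ = ((k : ℤ) + 1) * ((r - 1) * m)))
      linarith)
    (by
      rw [Finset.sum_range, Finset.sum_range]
      simp only [Fin.is_lt, dif_pos, Fin.eta]
      exact_mod_cast hsum)
  funext i
  have := key i i.2
  simpa using this

/-- Finitely many nonzero polynomials have a common point where none vanishes. -/
theorem exists_eval_ne_zero {K ι : Type*} [Field K] [Infinite K] (s : Finset ι)
    (p : ι → Polynomial K) (h : ∀ i ∈ s, p i ≠ 0) : ∃ u, ∀ i ∈ s, (p i).eval u ≠ 0 := by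
  have hprod : ∏ i ∈ s, p i ≠ 0 := Finset.prod_ne_zero_iff.2 h
  by_contra! hall
  refine hprod (Polynomial.funext fun u => ?_)
  obtain ⟨i, hi, h0⟩ := hall u
  rw [Polynomial.eval_prod, Polynomial.eval_zero]
  exact Finset.prod_eq_zero hi h0

end Separation

section BaseChange

variable {R S : Type*} [CommRing R] [CommRing S] (φ : R →+* S) {n : ℕ}

theorem map_exch (i j : Fin n) (f : MvPolynomial (Fin n) R) :
    MvPolynomial.map φ (exch R i j f) = exch S i j (MvPolynomial.map φ f) :=
  map_rename φ _ f

theorem map_monSymm (mu : Fin n → ℕ) :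
    MvPolynomial.map φ (monSymm R mu) = monSymm S mu := by
  simp [monSymm, map_monomial]

theorem map_eigenvalue (b u : R) (mu : Fin n → ℕ) :
    φ (eigenvalue b u mu) = eigenvalue (φ b) (φ u) mu := by
  simp [eigenvalue]

variable [IsDomain R] [IsDomain S]

theorem map_divDiff (i j : Fin n) (f : MvPolynomial (Fin n) R) :
    MvPolynomial.map φ (divDiff R i j f) = divDiff S i j (MvPolynomial.map φ f) := by
  rcases eq_or_ne i j with rfl | h
  · simp [divDiff_self]
  · symm
    apply eq_divDiff h
    rw [← map_exch, ← map_sub, ← X_sub_X_mul_divDiff h]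
    simp

theorem map_cherednik (b : R) (i : Fin n) (f : MvPolynomial (Fin n) R) :
    MvPolynomial.map φ (cherednik b i f) = cherednik (φ b) i (MvPolynomial.map φ f) := by
  simp only [cherednik_apply, dunkl_apply, map_add, map_mul, map_sum, map_X, smul_eq_C_mul, map_C,
    map_exch, map_divDiff, pderiv_map]

theorem map_sekiguchi (b u : R) (f : MvPolynomial (Fin n) R) :
    MvPolynomial.map φ (sekiguchi n b u f) =
      sekiguchi n (φ b) (φ u) (MvPolynomial.map φ f) := by
  rw [sekiguchi_eq, sekiguchi_eq, List.ofFn_eq_map, List.ofFn_eq_map]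
  induction List.finRange n with
  | nil => rfl
  | cons i l ih =>
    rw [List.map_cons, List.map_cons, List.prod_cons, List.prod_cons, Module.End.mul_apply,
      Module.End.mul_apply, ← ih]
    simp [sekFactor, map_cherednik, smul_eq_C_mul]

end BaseChange

section Regular

/-- The ring of rational functions without a pole at `b`. -/
def regularAt (b : ℂ) : Subring (RatFunc ℂ) where
  carrier := {f | f.denom.eval b ≠ 0}
  zero_mem' := by simp
  one_mem' := by simp
  add_mem' := fun {f g} hf hg h0 => by
    have := Polynomial.eval_dvd (x := b) (RatFunc.denom_add_dvd f g)
    rw [h0, zero_dvd_iff, Polynomial.eval_mul] at this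
    exact mul_ne_zero hf hg this
  mul_mem' := fun {f g} hf hg h0 => by
    have := Polynomial.eval_dvd (x := b) (RatFunc.denom_mul_dvd f g)
    rw [h0, zero_dvd_iff, Polynomial.eval_mul] at this
    exact mul_ne_zero hf hg this
  neg_mem' := fun {f} hf h0 => by
    have h1 : (-1 : RatFunc ℂ).denom = 1 := by
      have : (-1 : RatFunc ℂ) = algebraMap (Polynomial ℂ) _ (-1) := by simp
      rw [this, RatFunc.denom_algebraMap]
    have := Polynomial.eval_dvd (x := b) (RatFunc.denom_mul_dvd (-1) f)
    rw [neg_one_mul, h0, h1, one_mul, zero_dvd_iff] at this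
    exact hf this

theorem algebraMap_mem_regularAt (b : ℂ) (p : Polynomial ℂ) :
    algebraMap (Polynomial ℂ) (RatFunc ℂ) p ∈ regularAt b := by
  change (RatFunc.denom _).eval b ≠ 0
  simp

theorem inv_algebraMap_mem_regularAt {b : ℂ} {p : Polynomial ℂ} (h : p.eval b ≠ 0) :
    (algebraMap (Polynomial ℂ) (RatFunc ℂ) p)⁻¹ ∈ regularAt b := by
  intro h0
  have := Polynomial.eval_dvd (x := b) (RatFunc.denom_div_dvd 1 p)
  rw [map_one, one_div, h0, zero_dvd_iff] at this
  exact h this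

variable {n : ℕ}

theorem eigenvalue_X (u : ℂ) (mu : Fin n → ℕ) :
    eigenvalue (RatFunc.X : RatFunc ℂ) (RatFunc.C u) mu =
      algebraMap (Polynomial ℂ) (RatFunc ℂ) (eigenvalue Polynomial.X (Polynomial.C u) mu) := by
  rw [map_eigenvalue, RatFunc.algebraMap_X, RatFunc.algebraMap_C]

theorem eval_eigenvalue_X (b u : ℂ) (mu : Fin n → ℕ) :
    (eigenvalue Polynomial.X (Polynomial.C u) mu).eval b = eigenvalue b u mu := by
  rw [← Polynomial.coe_evalRingHom, map_eigenvalue]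
  simp

/-- Separation of eigenvalues at `β = b` implies separation over the rational functions. -/
theorem eigenvalue_X_ne {b u : ℂ} {mu lam : Fin n → ℕ}
    (h : eigenvalue b u lam ≠ eigenvalue b u mu) :
    eigenvalue (RatFunc.X : RatFunc ℂ) (RatFunc.C u) lam ≠
      eigenvalue RatFunc.X (RatFunc.C u) mu := by
  rw [eigenvalue_X, eigenvalue_X]
  intro h0
  have := congrArg (Polynomial.eval b) (RatFunc.algebraMap_injective ℂ h0)
  rw [eval_eigenvalue_X, eval_eigenvalue_X] at this
  exact h this

/-- The polynomials with coefficients regular at `b`. -/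
noncomputable def regularPoly (n : ℕ) (b : ℂ) : Subring (MvPolynomial (Fin n) (RatFunc ℂ)) :=
  (MvPolynomial.map (regularAt b).subtype).range

theorem noPoleAt_of_mem {b : ℂ} {P : MvPolynomial (Fin n) (RatFunc ℂ)} (h : P ∈ regularPoly n b) :
    NoPoleAt P b := by
  obtain ⟨Q, rfl⟩ := h
  intro a
  rw [coeff_map]
  exact (coeff a Q).2

theorem smul_mem_regularPoly {b : ℂ} {c : RatFunc ℂ} (hc : c ∈ regularAt b)
    {P : MvPolynomial (Fin n) (RatFunc ℂ)} (h : P ∈ regularPoly n b) :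
    c • P ∈ regularPoly n b := by
  rw [smul_eq_C_mul]
  exact mul_mem ⟨C ⟨c, hc⟩, by simp⟩ h

theorem sekiguchi_mem_regularPoly {b : ℂ} (x u : regularAt b)
    {P : MvPolynomial (Fin n) (RatFunc ℂ)} (h : P ∈ regularPoly n b) :
    sekiguchi n ((regularAt b).subtype x) ((regularAt b).subtype u) P ∈ regularPoly n b := by
  obtain ⟨Q, rfl⟩ := h
  rw [← map_sekiguchi]
  exact ⟨_, rfl⟩

theorem jackProj_mem_regularPoly {b u : ℂ} {lam : Fin n → ℕ}
    (h : ∀ mu, Antitone mu → StrictDom mu lam → eigenvalue b u lam ≠ eigenvalue b u mu) :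
    jackProj RatFunc.X (RatFunc.C u) lam ∈ regularPoly n b := by
  classical
  have hX : (RatFunc.X : RatFunc ℂ) ∈ regularAt b := by
    rw [← RatFunc.algebraMap_X]; exact algebraMap_mem_regularAt b _
  have hC : (RatFunc.C u : RatFunc ℂ) ∈ regularAt b := by
    rw [← RatFunc.algebraMap_C]; exact algebraMap_mem_regularAt b _
  refine smul_mem_regularPoly ?_ ?_
  · rw [lowerPoly, Polynomial.eval_prod, ← Finset.prod_inv_distrib]
    refine Subring.prod_mem _ fun mu hmu => ?_
    rw [Set.Finite.mem_toFinset] at hmu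
    rw [Polynomial.eval_sub, Polynomial.eval_X, Polynomial.eval_C, eigenvalue_X, eigenvalue_X,
      ← map_sub]
    apply inv_algebraMap_mem_regularAt
    rw [Polynomial.eval_sub, eval_eigenvalue_X, eval_eigenvalue_X, sub_ne_zero]
    exact h mu hmu.1 hmu.2
  · rw [lowerPoly]
    induction (finite_strictDom lam).toFinset using Finset.induction_on with
    | empty =>
      rw [Finset.prod_empty, map_one, Module.End.one_apply]
      exact ⟨monSymm _ lam, map_monSymm _ lam⟩
    | insert mu s hmu ih =>
      rw [Finset.prod_insert hmu, map_mul, Module.End.mul_apply, map_sub, Polynomial.aeval_X,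
        Polynomial.aeval_C, LinearMap.sub_apply, Module.algebraMap_end_apply]
      refine sub_mem (sekiguchi_mem_regularPoly ⟨_, hX⟩ ⟨_, hC⟩ ih) (smul_mem_regularPoly ?_ ih)
      rw [eigenvalue_X]
      exact algebraMap_mem_regularAt b _

theorem isJack_jackProj {u : RatFunc ℂ} {lam : Fin n → ℕ} (hlam : Antitone lam)
    (h : ∀ mu, Antitone mu → StrictDom mu lam →
      eigenvalue RatFunc.X u lam ≠ eigenvalue RatFunc.X u mu) :
    IsJack lam (jackProj RatFunc.X u lam) :=
  ⟨jackProj_sub_mem hlam h, fun v => sekiguchi_jackProj hlam h v⟩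

theorem IsJack.eq {u : RatFunc ℂ} {lam : Fin n → ℕ}
    (h : ∀ mu, Antitone mu → StrictDom mu lam →
      eigenvalue RatFunc.X u lam ≠ eigenvalue RatFunc.X u mu)
    {P Q : MvPolynomial (Fin n) (RatFunc ℂ)} (hP : IsJack lam P) (hQ : IsJack lam Q) : P = Q := by
  rw [← sub_eq_zero]
  refine eq_zero_of_mem_lower h ?_ (by rw [map_sub, hP.2, hQ.2, smul_sub])
  have := sub_mem hP.1 hQ.1
  rwa [sub_sub_sub_cancel_right] at this

end Regular

end JackPoly

theorem proposition2p1 (n k r : ℕ) (hk : 1 ≤ k) (hr : 2 ≤ r) (hkr : Nat.Coprime (k + 1) (r - 1))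
    (mu lam : Fin n → ℕ) (hmu : JackPoly.Admissible k r mu) (hlam : Antitone lam)
    (h : JackPoly.AddNode mu lam ∨ JackPoly.AddNode lam mu ∨ lam = mu) :
    (∃! P : MvPolynomial (Fin n) (RatFunc ℂ), JackPoly.IsJack lam P) ∧
      ∀ P : MvPolynomial (Fin n) (RatFunc ℂ), JackPoly.IsJack lam P →
        JackPoly.NoPoleAt P (-((r : ℂ) - 1) / ((k : ℂ) + 1)) := by
  set b : ℂ := -((r : ℂ) - 1) / ((k : ℂ) + 1)
  obtain ⟨a, gap⟩ := JackPoly.exists_gap hk hmu h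
  -- a value of `u` separating `lam` from all partitions below it, already at `β = b`
  obtain ⟨u, hu⟩ := JackPoly.exists_eval_ne_zero (JackPoly.finite_strictDom lam).toFinset
    (fun nu => JackPoly.eigenPoly b lam - JackPoly.eigenPoly b nu) (fun nu hnu h0 => by
      rw [Set.Finite.mem_toFinset] at hnu
      exact hnu.2.1 (JackPoly.eq_of_eigenPoly_eq hk (by omega) hkr hlam gap hnu.1 hnu.2.2.1
        (sub_eq_zero.1 h0).symm))
  have hsep : ∀ nu, Antitone nu → JackPoly.StrictDom nu lam →
      JackPoly.eigenvalue b u lam ≠ JackPoly.eigenvalue b u nu := fun nu h1 h2 => by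
    have := hu nu (by rw [Set.Finite.mem_toFinset]; exact ⟨h1, h2⟩)
    rwa [Polynomial.eval_sub, JackPoly.eval_eigenPoly, JackPoly.eval_eigenPoly, sub_ne_zero] at this
  have hsepX := fun nu h1 h2 => JackPoly.eigenvalue_X_ne (hsep nu h1 h2)
  have hJ := JackPoly.isJack_jackProj hlam hsepX
  exact ⟨⟨_, hJ, fun P hP => hP.eq hsepX hJ⟩, fun P hP => by
    rw [hP.eq hsepX hJ]
    exact JackPoly.noPoleAt_of_mem (JackPoly.jackProj_mem_regularPoly hsep)⟩
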